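/- Let $d\ge 1$ and let $\Omega\subset\mathbb R^d$ be a bounded open set with Lipschitz boundary. Let $s,a,f_w,f_2:\mathbb R\to\mathbb R$ and $\mathbf f_1,\mathbf f_3:\mathbb R\to\mathbb R^d$ satisfy: (A1) $s$ takes values in $[0,1]$ and is nondecreasing and Lipschitz continuous; (A2) $a$ is Lipschitz continuous and there are $a_\star,a^\star$ with $0<a_\star\le a(y)\le a^\star<\infty$ for all $y\in\mathbb R$; (A3) $\mathbf f_1,f_2,\mathbf f_3,f_w$ are Lipschitz continuous and $f_w$ is bounded. Let $\mathcal T_h$ be a conforming decomposition of $\overline\Omega$ into finitely many closed $d$-simplices (any two of them meet at most in a common face). Let $W_h\subset L^2(\Omega)$ be the space of functions that are constant on each $T\in\mathcal T_h$, and let $V_h$ be the lowest order Raviart--Thomas space of those $\mathbf v\in H(\mathrm{div};\Omega)$ that on each $T\in\mathcal T_h$ have the form $\mathbf v(\mathbf x)=\mathbf a_T+b_T\mathbf x$ with $\mathbf a_T\in\mathbb R^d$, $b_T\in\mathbb R$. Write $\langle\cdot,\cdot\rangle$ for the $L^2(\Omega)$ inner product. For a time step $\tau>0$ and a given previous state $\Theta_h^{n-1}\in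 L^2(\Omega)$ (in particular, any element of $W_h$, or the initial datum $\Theta_I\in L^2(\Omega)$ of (A5) if $n=1$), problem $P_h^n$ is to find $\Theta_h^n,p_h^n\in W_h$ and $\mathbf q_h^n,\mathbf u_h^n\in V_h$ such that, with $s_h^n:=s(\Theta_h^n)$ and $s_h^{n-1}:=s(\Theta_h^{n-1})$, \begin{align*} \langle s_h^n-s_h^{n-1},w_h\rangle+\tau\langle\nabla\cdot\mathbf q_h^n,w_h\rangle&=0,\\ \langle\mathbf q_h^n,\mathbf v_h\rangle-\langle\Theta_h^n,\nabla\cdot\mathbf v_h\rangle-\langle f_w(s_h^n)\mathbf u_h^n,\mathbf v_h\rangle&=\langle\mathbf f_1(s_h^n),\mathbf v_h\rangle,\\ \langle\nabla\cdot\mathbf u_h^n,w_h\rangle&=\langle f_2(s_h^n),w_h\rangle,\\ \langle a(s_h^n)\mathbf u_h^n,\mathbf v_h\rangle-\langle p_h^n,\nabla\cdot\mathbf v_h\rangle+\langle\mathbf f_3(s_h^n),\mathbf v_h\rangle&=0 \end{align*} for all $w_h\in W_h$ and all $\mathbf v_h\in V_h$. Then for all $\sigma,M_{\mathbf u}\in\mathbb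 R$ there is $\tau_0>0$, depending only on $d$, $\Omega$, the coefficient functions, $\sigma$ and $M_{\mathbf u}$, such that the following holds for every such decomposition $\mathcal T_h$ that is shape regular with constant $\sigma$ (each $T\in\mathcal T_h$ contains a ball of some diameter $\rho>0$ with $\operatorname{diam}T\le\sigma\rho$), every $\tau\in(0,\tau_0]$ and every $\Theta_h^{n-1}\in L^2(\Omega)$: if (A4) every solution of $P_h^n$ satisfies $\|\mathbf u_h^n\|_{L^\infty(\Omega)}\le M_{\mathbf u}$, then $P_h^n$ has at most one solution $(\Theta_h^n,\mathbf q_h^n,p_h^n,\mathbf u_h^n)$. -/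

import Mathlib

open MeasureTheory Set
open scoped ContDiff NNReal

noncomputable section

/-- The Euclidean space `ℝᵈ`. -/
abbrev Euc (d : ℕ) : Type := EuclideanSpace ℝ (Fin d)

/-- `L²(Ω)`. -/
abbrev L2Scal {d : ℕ} (Ω : Set (Euc d)) : Type := Lp ℝ 2 (volume.restrict Ω)

/-- `L²(Ω)ᵈ`. -/
abbrev L2Vec {d : ℕ} (Ω : Set (Euc d)) : Type := Lp (Euc d) 2 (volume.restrict Ω)

/-- `Ω` has a Lipschitz boundary: near each boundary point, for a suitable unit vector `e`
(the local vertical direction), `Ω` is the strict epigraph of a Lipschitz function `γ` of the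
component `y - ⟪e, y⟫ e` orthogonal to `e`. -/
def HasLipschitzBoundary {d : ℕ} (Ω : Set (Euc d)) : Prop :=
  ∀ x ∈ frontier Ω, ∃ (e : Euc d) (r : ℝ) (K : ℝ≥0) (γ : Euc d → ℝ),
    ‖e‖ = 1 ∧ 0 < r ∧ LipschitzWith K γ ∧
      ∀ y ∈ Metric.ball x r, (y ∈ Ω ↔ γ (y - inner ℝ e y • e) < inner ℝ e y)

/-- `g` is the weak divergence of `v` in `Ω`, tested with `C_c^∞(Ω)`. -/
def HasWeakDiv {d : ℕ} (Ω : Set (Euc d)) (v : L2Vec Ω) (g : L2Scal Ω) : Prop :=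
  ∀ φ : Euc d → ℝ, ContDiff ℝ ∞ φ → HasCompactSupport φ → tsupport φ ⊆ Ω →
    ∫ x in Ω, inner ℝ (v x) (gradient φ x) = -∫ x in Ω, g x * φ x

/-- The space `H(div; Ω)`: square integrable vector fields with a square integrable weak
divergence. -/
def Hdiv {d : ℕ} (Ω : Set (Euc d)) : Type :=
  {v : L2Vec Ω // ∃ g : L2Scal Ω, HasWeakDiv Ω v g}

namespace Hdiv

variable {d : ℕ} {Ω : Set (Euc d)}

/-- The underlying `L²` vector field. -/
def toL2 (v : Hdiv Ω) : L2Vec Ω := v.1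

/-- The weak divergence `∇ · v` of `v ∈ H(div; Ω)`. -/
def div (v : Hdiv Ω) : L2Scal Ω := v.2.choose

theorem hasWeakDiv_div (v : Hdiv Ω) : HasWeakDiv Ω v.toL2 v.div := v.2.choose_spec

/-- The weak divergence is unique, so `div` does not depend on the choice made. -/
theorem div_eq_of_hasWeakDiv (hΩ : IsOpen Ω) (v : Hdiv Ω) (g : L2Scal Ω)
    (hg : HasWeakDiv Ω v.toL2 g) : v.div = g := by
  have key : ∀ᵐ x ∂(volume : Measure (Euc d)), x ∈ Ω → (v.div x - g x) = 0 := by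
    have hloc : ∀ f : L2Scal Ω, LocallyIntegrableOn f Ω volume := fun f => by
      rw [locallyIntegrableOn_iff hΩ.isLocallyClosed]
      intro k hk hkc
      have h1 : MemLp f 2 (volume.restrict k) :=
        (Lp.memLp f).mono_measure (Measure.restrict_mono hk le_rfl)
      have : IsFiniteMeasure (volume.restrict k) :=
        ⟨by simpa using hkc.measure_lt_top⟩
      exact h1.integrable (by norm_num)
    refine hΩ.ae_eq_zero_of_integral_contDiff_smul_eq_zero ((hloc v.div).sub (hloc g)) ?_
    intro φ hφ hc hs
    have hφ2 : MemLp φ 2 (volume.restrict Ω) :=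
      (hφ.continuous.memLp_of_hasCompactSupport hc).restrict Ω
    have i1 : Integrable (fun x => v.div x * φ x) (volume.restrict Ω) :=
      (Lp.memLp v.div).integrable_mul hφ2
    have i2 : Integrable (fun x => g x * φ x) (volume.restrict Ω) :=
      (Lp.memLp g).integrable_mul hφ2
    have e1 := v.hasWeakDiv_div φ hφ hc hs
    have e2 := hg φ hφ hc hs
    have e3 : ∫ x in Ω, (v.div x * φ x - g x * φ x) = 0 := by
      rw [integral_sub i1 i2]; linarith
    rw [← setIntegral_eq_integral_of_forall_compl_eq_zero (s := Ω), ← e3]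
    · refine integral_congr_ae (Filter.Eventually.of_forall fun x => ?_)
      simp only [smul_eq_mul]; ring
    · intro x hx
      rw [image_eq_zero_of_notMem_tsupport (fun h => hx (hs h)), zero_smul]
  refine Lp.ext ?_
  refine (ae_restrict_iff' hΩ.measurableSet).2 ?_
  filter_upwards [key] with x hx hxΩ
  exact sub_eq_zero.1 (hx hxΩ)

end Hdiv

/-- A conforming decomposition of the closure of `Ω` into finitely many closed `d`-simplices.
A simplex is given by the set of its `d + 1` vertices; two simplices meet at most in a common
face. -/
structure SimplicialMesh {d : ℕ} (Ω : Set (Euc d)) where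
  /-- the vertex sets of the simplices -/
  cells : Finset (Finset (Euc d))
  card_eq : ∀ T ∈ cells, T.card = d + 1
  affineIndependent : ∀ T ∈ cells, AffineIndependent ℝ ((↑) : T → Euc d)
  inter_subset : ∀ S ∈ cells, ∀ T ∈ cells,
    convexHull ℝ (S : Set (Euc d)) ∩ convexHull ℝ (T : Set (Euc d)) ⊆
      convexHull ℝ ((S : Set (Euc d)) ∩ (T : Set (Euc d)))
  cover : ⋃ T ∈ cells, convexHull ℝ (T : Set (Euc d)) = closure Ω

namespace SimplicialMesh

variable {d : ℕ} {Ω : Set (Euc d)}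

/-- Shape regularity with constant `σ`: every simplex `T` contains a ball of some diameter
`2 r > 0` with `diam T ≤ σ · 2 r`. -/
def IsShapeRegular (M : SimplicialMesh Ω) (σ : ℝ) : Prop :=
  ∀ T ∈ M.cells, ∃ (c : Euc d) (r : ℝ), 0 < r ∧
    Metric.closedBall c r ⊆ convexHull ℝ (T : Set (Euc d)) ∧
      Metric.diam (convexHull ℝ (T : Set (Euc d))) ≤ σ * (2 * r)

/-- `W_h`: the functions in `L²(Ω)` that are constant on each simplex. -/
def Wh (M : SimplicialMesh Ω) : Set (L2Scal Ω) :=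
  {w | ∀ T ∈ M.cells, ∃ c : ℝ,
    ∀ᵐ x ∂(volume.restrict Ω), x ∈ convexHull ℝ (T : Set (Euc d)) → w x = c}

/-- `V_h`, the lowest order Raviart-Thomas space: the fields in `H(div; Ω)` that are of the form
`x ↦ a_T + b_T x` on each simplex `T`. -/
def Vh (M : SimplicialMesh Ω) : Set (Hdiv Ω) :=
  {v | ∀ T ∈ M.cells, ∃ (a : Euc d) (b : ℝ),
    ∀ᵐ x ∂(volume.restrict Ω), x ∈ convexHull ℝ (T : Set (Euc d)) → v.toL2 x = a + b • x}

end SimplicialMesh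

/-- The coefficient functions of the two-phase flow model. -/
structure FlowCoeffs (d : ℕ) where
  /-- the saturation as a function of the complementary pressure -/
  s : ℝ → ℝ
  a : ℝ → ℝ
  fw : ℝ → ℝ
  f1 : ℝ → Euc d
  f2 : ℝ → ℝ
  f3 : ℝ → Euc d

/-- The structural assumptions (A1), (A2), (A3) on the coefficient functions. -/
structure FlowCoeffs.Admissible {d : ℕ} (c : FlowCoeffs d) : Prop where
  s_mem : ∀ y, c.s y ∈ Icc (0 : ℝ) 1
  s_mono : Monotone c.s
  s_lip : ∃ K : ℝ≥0, LipschitzWith K c.s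
  a_lip : ∃ K : ℝ≥0, LipschitzWith K c.a
  a_bounds : ∃ aLow aUp : ℝ, 0 < aLow ∧ ∀ y, aLow ≤ c.a y ∧ c.a y ≤ aUp
  f1_lip : ∃ K : ℝ≥0, LipschitzWith K c.f1
  f2_lip : ∃ K : ℝ≥0, LipschitzWith K c.f2
  f3_lip : ∃ K : ℝ≥0, LipschitzWith K c.f3
  fw_lip : ∃ K : ℝ≥0, LipschitzWith K c.fw
  fw_bdd : ∃ B : ℝ, ∀ y, |c.fw y| ≤ B

/-- A quadruple `(Θ, q, p, u)` of unknowns at one time level. -/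
structure FlowState {d : ℕ} (Ω : Set (Euc d)) where
  Θ : L2Scal Ω
  q : Hdiv Ω
  p : L2Scal Ω
  u : Hdiv Ω

/-- `X = (Θ, q, p, u)` solves the fully discrete problem `P_hⁿ` (backward Euler in time with step
`τ`, lowest order Raviart-Thomas mixed finite elements in space), where `Θprev` is the
complementary pressure at the previous time level. -/
structure IsDiscreteSolution {d : ℕ} {Ω : Set (Euc d)} (c : FlowCoeffs d)
    (M : SimplicialMesh Ω) (τ : ℝ) (Θprev : L2Scal Ω) (X : FlowState Ω) : Prop where
  Θ_mem : X.Θ ∈ M.Wh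
  q_mem : X.q ∈ M.Vh
  p_mem : X.p ∈ M.Wh
  u_mem : X.u ∈ M.Vh
  saturation_eq : ∀ w ∈ M.Wh,
    (∫ x in Ω, (c.s (X.Θ x) - c.s (Θprev x)) * w x) + τ * (∫ x in Ω, X.q.div x * w x) = 0
  flux_eq : ∀ v ∈ M.Vh,
    (∫ x in Ω, inner ℝ (X.q.toL2 x) (v.toL2 x)) - (∫ x in Ω, X.Θ x * v.div x)
        - (∫ x in Ω, inner ℝ (c.fw (c.s (X.Θ x)) • X.u.toL2 x) (v.toL2 x))
      = ∫ x in Ω, inner ℝ (c.f1 (c.s (X.Θ x))) (v.toL2 x)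
  total_flux_eq : ∀ w ∈ M.Wh,
    (∫ x in Ω, X.u.div x * w x) = ∫ x in Ω, c.f2 (c.s (X.Θ x)) * w x
  pressure_eq : ∀ v ∈ M.Vh,
    (∫ x in Ω, inner ℝ (c.a (c.s (X.Θ x)) • X.u.toL2 x) (v.toL2 x))
        - (∫ x in Ω, X.p x * v.div x)
        + (∫ x in Ω, inner ℝ (c.f3 (c.s (X.Θ x))) (v.toL2 x)) = 0

/-- The bound (A4) for the total flux: every solution of `P_hⁿ` satisfies `‖u‖_∞ ≤ Mu`. -/
def TotalFluxBound {d : ℕ} {Ω : Set (Euc d)} (c : FlowCoeffs d)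
    (M : SimplicialMesh Ω) (τ : ℝ) (Θprev : L2Scal Ω) (Mu : ℝ) : Prop :=
  ∀ X : FlowState Ω, IsDiscreteSolution c M τ Θprev X →
    ∀ᵐ x ∂(volume.restrict Ω), ‖X.u.toL2 x‖ ≤ Mu

end

/-!
Write `δ` for the difference of two solutions and `S = s(Θ)`. Testing the saturation equation with
`δΘ` and the flux equation with `δq` gives `⟨δS, δΘ⟩ + τ ‖δq‖² = τ ⟨δF, δq⟩`, where `F` is the
convective flux. Since `s` is nondecreasing and `K`-Lipschitz, `‖δS‖² ≤ K ⟨δS, δΘ⟩`. Darcy's law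
bounds `δu` by `δS`, the pressure difference being controlled through an inf-sup inequality, and
the bound on one of the two total fluxes then gives `‖δF‖ ≤ N ‖δS‖`. By Young's inequality
`‖δS‖² ≤ (K N² τ / 4) ‖δS‖²`, so `δS = 0` for small `τ`; then `δu`, `δq` and `δp` vanish, and the
inf-sup inequality applied to the flux equation gives `δΘ = 0`.

The inf-sup constant has to be uniform over the shape regular meshes. To a piecewise constant `w`
one assigns the Raviart–Thomas field `v` whose flux through a face is a weighted jump of `w`
(the full value of `w` on boundary faces). Then `⟨w, div v⟩` is the jump energy of `w`, which
bounds `‖v‖²` by a scaling argument and `‖w‖²` by a discrete Poincaré inequality. That `v` lies in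
`H(div; Ω)` requires the divergence theorem on a simplex, which is obtained without surface
integrals by differentiating volume integrals over homothetic copies.
-/

noncomputable section

section Radial

theorem image_homothety_subset {E : Type*} [NormedAddCommGroup E] [NormedSpace ℝ E] {K : Set E}
    {z : E} (hstar : StarConvex ℝ z K) {t : ℝ} (ht : t ∈ Icc (0 : ℝ) 1) :
    AffineMap.homothety z t '' K ⊆ K := by
  rintro _ ⟨x, hx, rfl⟩
  rw [AffineMap.homothety_eq_lineMap]
  exact hstar.segment_subset hx (lineMap_mem_segment ℝ z x ht)

variable {E : Type*} [NormedAddCommGroup E] [NormedSpace ℝ E] [MeasurableSpace E]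
  [BorelSpace E] (μ : Measure E) [μ.IsAddHaarMeasure]

theorem hasDerivAt_setIntegral_homothety {K : Set E} (hK : IsCompact K) (z : E) {η : E → ℝ}
    (hη : ContDiff ℝ 1 η) :
    HasDerivAt (fun t : ℝ => ∫ x in K, t ^ Module.finrank ℝ E * η (AffineMap.homothety z t x) ∂μ)
      (∫ x in K, (Module.finrank ℝ E * η x + fderiv ℝ η x (x - z)) ∂μ) 1 := by
  set n := Module.finrank ℝ E
  let G (t : ℝ) (x : E) : ℝ := t ^ n * η (AffineMap.homothety z t x)
  let G' (t : ℝ) (x : E) : ℝ := n * t ^ (n - 1) * η (AffineMap.homothety z t x) +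
    t ^ n * fderiv ℝ η (AffineMap.homothety z t x) (x - z)
  have := hη.continuous_fderiv one_ne_zero
  have := hη.continuous
  have hG' : Continuous fun y : ℝ × E => G' y.1 y.2 := by
    simp only [G', AffineMap.homothety_apply, vsub_eq_sub, vadd_eq_add]
    fun_prop
  have hGc : ∀ t, Continuous (G t) := fun t => by
    simp only [G, AffineMap.homothety_apply, vsub_eq_sub, vadd_eq_add]
    fun_prop
  obtain ⟨B, hB⟩ := ((isCompact_closedBall (1 : ℝ) 1).prod hK).exists_bound_of_continuousOn
    hG'.continuousOn
  have hderiv : ∀ t x, HasDerivAt (fun t => G t x) (G' t x) t := fun t x => by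
    have hline : HasDerivAt (fun t : ℝ => AffineMap.homothety z t x) (x - z) t := by
      simpa [AffineMap.homothety_apply] using
        ((hasDerivAt_id t).smul_const (x - z)).add_const z
    exact (hasDerivAt_pow n t).mul
      (((hη.differentiable one_ne_zero) _).hasFDerivAt.comp_hasDerivAt t hline)
  have := (hasDerivAt_integral_of_dominated_loc_of_deriv_le (μ := μ.restrict K) (F := G) (F' := G')
    (bound := fun _ => B) (Metric.closedBall_mem_nhds (1 : ℝ) one_pos)
    (.of_forall fun t => (hGc t).aestronglyMeasurable)
    ((hGc 1).continuousOn.integrableOn_compact hK)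
    (hG'.comp (Continuous.prodMk_right 1)).aestronglyMeasurable
    (ae_restrict_of_forall_mem hK.measurableSet fun x hx t ht => hB (t, x) ⟨ht, hx⟩)
    (continuous_const.continuousOn.integrableOn_compact hK)
    (.of_forall fun x t _ => hderiv t x)).2
  simpa [G, G'] using this

variable [FiniteDimensional ℝ E]

theorem setIntegral_image_homothety (η : E → ℝ) {K : Set E} (hK : MeasurableSet K) (z : E) {t : ℝ}
    (ht : 0 < t) :
    ∫ x in AffineMap.homothety z t '' K, η x ∂μ =
      t ^ Module.finrank ℝ E * ∫ x in K, η (AffineMap.homothety z t x) ∂μ := by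
  have hderiv : ∀ x ∈ K, HasFDerivWithinAt (AffineMap.homothety z t)
      (t • ContinuousLinearMap.id ℝ E) K x := fun x _ =>
    ((((hasFDerivAt_id x).sub_const z).const_smul t).add_const z).hasFDerivWithinAt
  have hinj : InjOn (AffineMap.homothety z t) K := fun x _ y _ h => by
    simpa [AffineMap.homothety_apply, ht.ne'] using h
  rw [integral_image_eq_integral_abs_det_fderiv_smul μ hK hderiv hinj, integral_smul,
    ContinuousLinearMap.det, ContinuousLinearMap.toLinearMap_smul, LinearMap.det_smul]
  simp [abs_of_pos ht]

theorem norm_setIntegral_homothety_sub_le {K : Set E} (hK : IsCompact K) {z : E}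
    (hstar : StarConvex ℝ z K) {η : E → ℝ} (hη : Continuous η) {C t : ℝ} (hC0 : 0 ≤ C)
    (ht : t ∈ Ioc (0 : ℝ) 1)
    (hC : ∀ x ∈ K, x ∉ AffineMap.homothety z t '' K → |η x| ≤ C * (1 - t)) :
    |(∫ x in K, t ^ Module.finrank ℝ E * η (AffineMap.homothety z t x) ∂μ) - ∫ x in K, η x ∂μ| ≤
      C * (Module.finrank ℝ E * μ.real K) * (1 - t) ^ 2 := by
  set n := Module.finrank ℝ E with hn
  set Kt := AffineMap.homothety z t '' K with hKt
  have hKtm : MeasurableSet Kt :=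
    (hK.image (AffineMap.homothety z t).continuous_of_finiteDimensional).measurableSet
  have hsub : Kt ⊆ K := image_homothety_subset hstar (Ioc_subset_Icc_self ht)
  have hmeas : μ.real (K \ Kt) ≤ n * μ.real K * (1 - t) := by
    have hvol : μ.real Kt = t ^ n * μ.real K := by
      rw [Measure.real, hKt, Measure.addHaar_image_homothety, ← hn, ENNReal.toReal_mul,
        ENNReal.toReal_ofReal (abs_nonneg _), abs_of_pos (pow_pos ht.1 n), Measure.real]
    have hbern : 1 + n * (t - 1) ≤ t ^ n := by
      simpa using one_add_mul_le_pow (a := t - 1) (by linarith [ht.1]) n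
    rw [measureReal_sdiff hsub hKtm hK.measure_lt_top.ne, hvol]
    nlinarith [measureReal_nonneg (μ := μ) (s := K)]
  have hdiff : (∫ x in K, t ^ n * η (AffineMap.homothety z t x) ∂μ) - ∫ x in K, η x ∂μ =
      -∫ x in K \ Kt, η x ∂μ := by
    rw [integral_const_mul, hn, ← setIntegral_image_homothety μ η hK.measurableSet z ht.1,
      setIntegral_sdiff hKtm (hη.continuousOn.integrableOn_compact hK) hsub]
    ring
  rw [hdiff, abs_neg, ← Real.norm_eq_abs]
  calc ‖∫ x in K \ Kt, η x ∂μ‖ ≤ C * (1 - t) * μ.real (K \ Kt) :=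
        norm_setIntegral_le_of_norm_le_const
          ((measure_mono sdiff_subset).trans_lt hK.measure_lt_top) fun x hx => hC x hx.1 hx.2
    _ ≤ C * (1 - t) * (n * μ.real K * (1 - t)) := by
        gcongr
        exact mul_nonneg hC0 (by linarith [ht.2])
    _ = C * (n * μ.real K) * (1 - t) ^ 2 := by ring

/-- The integrand is the divergence of `x ↦ η x • (x - z)`. The integral of `η` over the
homothetic image of `K` with ratio `t` differs from that over `K` by `O((1 - t) ^ 2)`, so its
derivative at `t = 1` vanishes. -/
theorem setIntegral_add_fderiv_eq_zero {K : Set E} (hK : IsCompact K) {z : E}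
    (hstar : StarConvex ℝ z K) {η : E → ℝ} (hη : ContDiff ℝ 1 η) {C : ℝ} (hC0 : 0 ≤ C)
    (hC : ∀ t ∈ Ioc (0 : ℝ) 1, ∀ x ∈ K, x ∉ AffineMap.homothety z t '' K →
      |η x| ≤ C * (1 - t)) :
    ∫ x in K, (Module.finrank ℝ E * η x + fderiv ℝ η x (x - z)) ∂μ = 0 := by
  set G : ℝ → ℝ := fun t =>
    ∫ x in K, t ^ Module.finrank ℝ E * η (AffineMap.homothety z t x) ∂μ with hG
  have hG1 : G 1 = ∫ x in K, η x ∂μ := by simp [hG]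
  have hquad : (fun t => G t - G 1) =O[nhdsWithin 1 (Iic 1)] fun t => ‖t - 1‖ ^ 2 := by
    refine Asymptotics.IsBigO.of_bound (C * (Module.finrank ℝ E * μ.real K)) ?_
    filter_upwards [Ioc_mem_nhdsLE zero_lt_one] with t ht
    have := norm_setIntegral_homothety_sub_le μ hK hstar hη.continuous hC0 ht (hC t ht)
    rwa [hG1, Real.norm_eq_abs, norm_pow, norm_norm, Real.norm_eq_abs, sq_abs, ← neg_sq, neg_sub]
  have hzero : HasDerivWithinAt G 0 (Iic 1) 1 := by
    have := (hquad.hasFDerivWithinAt self_mem_Iic one_lt_two).hasDerivWithinAt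
    simpa using this.add_const (G 1)
  exact ((uniqueDiffOn_Iic 1) 1 self_mem_Iic).eq_deriv _
    (hasDerivAt_setIntegral_homothety μ hK z hη).hasDerivWithinAt hzero

end Radial

section Simplex

theorem mem_and_ne_of_erase_eq {α : Type*} [DecidableEq α] {S T : Finset α} {a b c : α}
    (h : S.erase a = T.erase b) (hc : c ∈ T) (hne : c ≠ b) : c ∈ S ∧ c ≠ a := by
  rw [and_comm, ← Finset.mem_erase, h]
  exact Finset.mem_erase.2 ⟨hne, hc⟩

variable {E : Type*} [NormedAddCommGroup E] [NormedSpace ℝ E] {T T' : Finset E} {w x y z z' : E}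

/-- `T` is the set of vertices of a nondegenerate simplex of full dimension in `E`. -/
structure IsSimplex (T : Finset E) : Prop where
  card_eq : T.card = Module.finrank ℝ E + 1
  affineIndependent : AffineIndependent ℝ ((↑) : T → E)

theorem isCompact_convexHull_finset (T : Finset E) : IsCompact (convexHull ℝ (T : Set E)) :=
  T.finite_toSet.isCompact_convexHull ℝ

variable [FiniteDimensional ℝ E]

theorem hasFDerivAt_affineMap (A : E →ᵃ[ℝ] E) (x : E) :
    HasFDerivAt A A.linear.toContinuousLinearMap x := by
  have hdecomp : ⇑A = fun x => A.linear.toContinuousLinearMap x + A 0 :=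
    funext fun x => by simpa using A.map_vadd 0 x
  rw [hdecomp]
  exact (ContinuousLinearMap.hasFDerivAt _).add_const (A 0)

/-- The affine basis formed by the vertices of a simplex. -/
def IsSimplex.basis (hT : IsSimplex T) : AffineBasis T ℝ E where
  toFun := (↑)
  ind' := hT.affineIndependent
  tot' := by
    rw [hT.affineIndependent.affineSpan_eq_top_iff_card_eq_finrank_add_one]
    simpa using hT.card_eq

open Classical in
/-- The barycentric coordinate belonging to the vertex `z` of the simplex `T`, with the junk value
`0` if `T` is not a simplex or `z` is not one of its vertices. -/
def bary (T : Finset E) (z : E) : E →ᵃ[ℝ] ℝ :=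
  if h : IsSimplex T ∧ z ∈ T then h.1.basis.coord ⟨z, h.2⟩ else 0

/-- The relative interior of the face of the simplex `T` opposite to the vertex `z`. -/
def openFace (T : Finset E) (z : E) : Set E :=
  {x | bary T z x = 0 ∧ ∀ w ∈ T, w ≠ z → 0 < bary T w x}

/-- The affine map which fixes the face of the simplex `T` opposite to `z` and maps `z` to `z'`. -/
def moveApex (T : Finset E) (z z' : E) : E →ᵃ[ℝ] E :=
  AffineMap.id ℝ E + (LinearMap.toSpanSingleton ℝ E (z' - z)).toAffineMap.comp (bary T z)

theorem moveApex_apply (T : Finset E) (z z' x : E) :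
    moveApex T z z' x = x + bary T z x • (z' - z) := rfl

theorem moveApex_linear (T : Finset E) (z z' : E) :
    (moveApex T z z').linear = LinearMap.transvection (bary T z).linear (z' - z) := rfl

namespace IsSimplex

theorem range_basis (hT : IsSimplex T) : range hT.basis = (T : Set E) := Subtype.range_coe

theorem bary_eq (hT : IsSimplex T) (hz : z ∈ T) : bary T z = hT.basis.coord ⟨z, hz⟩ :=
  dif_pos ⟨hT, hz⟩

theorem bary_self (hT : IsSimplex T) (hz : z ∈ T) : bary T z z = 1 := by
  rw [hT.bary_eq hz]
  exact hT.basis.coord_apply_eq ⟨z, hz⟩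

theorem bary_of_ne (hT : IsSimplex T) (hz : z ∈ T) (hw : w ∈ T) (h : w ≠ z) :
    bary T z w = 0 := by
  rw [hT.bary_eq hz]
  exact hT.basis.coord_apply_ne (i := ⟨z, hz⟩) (j := ⟨w, hw⟩) fun e =>
    h (congrArg Subtype.val e).symm

theorem sum_bary (hT : IsSimplex T) (x : E) : ∑ z ∈ T, bary T z x = 1 := by
  rw [← Finset.sum_attach, ← hT.basis.sum_coord_apply_eq_one x]
  exact Finset.sum_congr rfl fun z _ => by rw [hT.bary_eq z.2]

theorem sum_bary_smul (hT : IsSimplex T) (x : E) : ∑ z ∈ T, bary T z x • z = x := by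
  conv_rhs => rw [← hT.basis.linear_combination_coord_eq_self x]
  rw [← Finset.sum_attach]
  exact Finset.sum_congr rfl fun z _ => by rw [hT.bary_eq z.2]; rfl

theorem affineMap_ext {F : Type*} [AddCommGroup F] [Module ℝ F] (hT : IsSimplex T)
    {f g : E →ᵃ[ℝ] F} (h : ∀ z ∈ T, f z = g z) : f = g :=
  AffineMap.ext_on (s := range hT.basis) hT.basis.tot (by rwa [hT.range_basis])

theorem mem_convexHull (hT : IsSimplex T) :
    x ∈ convexHull ℝ (T : Set E) ↔ ∀ z ∈ T, 0 ≤ bary T z x := by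
  rw [← hT.range_basis, hT.basis.convexHull_eq_nonneg_coord]
  exact ⟨fun h z hz => by rw [hT.bary_eq hz]; exact h _,
    fun h z => by rw [← hT.bary_eq z.2]; exact h _ z.2⟩

theorem mem_interior (hT : IsSimplex T) :
    x ∈ interior (convexHull ℝ (T : Set E)) ↔ ∀ z ∈ T, 0 < bary T z x := by
  rw [← hT.range_basis, hT.basis.interior_convexHull]
  exact ⟨fun h z hz => by rw [hT.bary_eq hz]; exact h _,
    fun h z => by rw [← hT.bary_eq z.2]; exact h _ z.2⟩

theorem nonempty_interior (hT : IsSimplex T) : (interior (convexHull ℝ (T : Set E))).Nonempty := by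
  rw [← hT.range_basis]
  exact ⟨_, hT.basis.centroid_mem_interior_convexHull⟩

theorem bary_le_one (hT : IsSimplex T) (hz : z ∈ T) (hx : x ∈ convexHull ℝ (T : Set E)) :
    bary T z x ≤ 1 := by
  rw [← hT.sum_bary x]
  exact Finset.single_le_sum (f := fun z => bary T z x) (fun w hw => hT.mem_convexHull.1 hx w hw) hz

theorem bary_eq_zero_of_mem_convexHull (hT : IsSimplex T) (hz : z ∈ T) {F : Set E}
    (hFT : F ⊆ T) (hzF : z ∉ F) (hx : x ∈ convexHull ℝ F) : bary T z x = 0 :=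
  convexHull_min (t := {x | bary T z x = 0})
    (fun _ hw => hT.bary_of_ne hz (hFT hw) (ne_of_mem_of_not_mem hw hzF))
    ((convex_singleton (0 : ℝ)).affine_preimage (bary T z)) hx

theorem exists_eq_lineMap_of_bary_lt_one (hT : IsSimplex T) (hz : z ∈ T) (hx : bary T z x < 1) :
    ∃ y, bary T z y = 0 ∧ (∀ w ∈ T, w ≠ z → bary T w y = (1 - bary T z x)⁻¹ * bary T w x) ∧
      x = AffineMap.lineMap y z (bary T z x) := by
  have h0 : 1 - bary T z x ≠ 0 := (sub_pos.2 hx).ne'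
  refine ⟨AffineMap.lineMap z x (1 - bary T z x)⁻¹, ?_, fun w hw hwz => ?_, ?_⟩
  · rw [AffineMap.apply_lineMap, hT.bary_self hz, AffineMap.lineMap_apply_ring]
    field_simp
    ring
  · rw [AffineMap.apply_lineMap, hT.bary_of_ne hw hz hwz.symm, AffineMap.lineMap_apply_ring]
    ring
  · simp only [AffineMap.lineMap_apply_module, smul_add, smul_smul]
    rw [mul_inv_cancel₀ h0, add_right_comm, mul_sub, mul_inv_cancel₀ h0, ← add_smul]
    simp

theorem eventually_lineMap_mem_convexHull (hT : IsSimplex T) (hx : x ∈ openFace T z)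
    (hy : 0 ≤ bary T z y) :
    ∀ᶠ t in nhdsWithin (0 : ℝ) (Ioi 0), AffineMap.lineMap x y t ∈ convexHull ℝ (T : Set E) := by
  simp only [hT.mem_convexHull, AffineMap.apply_lineMap]
  rw [Filter.eventually_all_finset]
  intro w hw
  rcases eq_or_ne w z with rfl | hwz
  · filter_upwards [self_mem_nhdsWithin] with t ht
    rw [hx.1, AffineMap.lineMap_apply_ring, mul_zero, zero_add]
    exact mul_nonneg (le_of_lt ht) hy
  · have hcont : Continuous fun t : ℝ => AffineMap.lineMap (bary T w x) (bary T w y) t :=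
      AffineMap.lineMap_continuous
    have hpos := (hcont.tendsto 0).mono_left (nhdsWithin_le_nhds (s := Ioi 0))
      |>.eventually_const_lt (u := 0) (by simpa using hx.2 w hw hwz)
    exact hpos.mono fun t ht => ht.le

theorem linear_bary_mul_le (hT : IsSimplex T) (hz : z ∈ T) {c : E} {r : ℝ} (hr : 0 < r)
    (hball : Metric.closedBall c r ⊆ convexHull ℝ (T : Set E)) (v : E) :
    (bary T z).linear v * (2 * r) ≤ ‖v‖ := by
  rcases eq_or_ne v 0 with rfl | hv
  · simp
  have hv0 : 0 < ‖v‖ := norm_pos_iff.2 hv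
  set u : E := (r / ‖v‖) • v with hu
  have hun : ‖u‖ = r := by
    rw [hu, norm_smul, Real.norm_of_nonneg (by positivity), div_mul_cancel₀ _ hv0.ne']
  have hle : bary T z (c + u) ≤ 1 := hT.bary_le_one hz (hball (by simp [hun]))
  have hge : 0 ≤ bary T z (c - u) := hT.mem_convexHull.1 (hball (by simp [hun])) z hz
  have hdiff : bary T z (c + u) - bary T z (c - u) = (bary T z).linear v * (2 * r) / ‖v‖ := by
    rw [← vsub_eq_sub, ← AffineMap.linearMap_vsub, vsub_eq_sub,
      show c + u - (c - u) = (2 * r / ‖v‖) • v by rw [hu, mul_div_assoc, mul_smul, two_smul]; abel,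
      map_smul, smul_eq_mul]
    ring
  rw [← div_le_one hv0, ← hdiff]
  linarith

theorem abs_linear_bary_mul_le (hT : IsSimplex T) (hz : z ∈ T) {c : E} {r : ℝ} (hr : 0 < r)
    (hball : Metric.closedBall c r ⊆ convexHull ℝ (T : Set E)) (v : E) :
    |(bary T z).linear v| * (2 * r) ≤ ‖v‖ := by
  rcases abs_choice ((bary T z).linear v) with h | h <;> rw [h]
  · exact hT.linear_bary_mul_le hz hr hball v
  · simpa using hT.linear_bary_mul_le hz hr hball (-v)

theorem moveApex_self (hT : IsSimplex T) (hz : z ∈ T) : moveApex T z z' z = z' := by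
  rw [moveApex_apply, hT.bary_self hz, one_smul, add_sub_cancel]

theorem det_moveApex_linear (hT : IsSimplex T) (hz : z ∈ T) :
    LinearMap.det (moveApex T z z').linear = bary T z z' := by
  rw [moveApex_linear, LinearMap.transvection.det, ← vsub_eq_sub, AffineMap.linearMap_vsub,
    hT.bary_self hz]
  simp

variable [DecidableEq E]

theorem mem_convexHull_erase (hT : IsSimplex T) (hx : x ∈ convexHull ℝ (T : Set E))
    (hxz : bary T z x = 0) : x ∈ convexHull ℝ (T.erase z : Set E) := by
  rw [← hT.sum_bary_smul x, ← Finset.sum_erase T (a := z) (by rw [hxz, zero_smul])]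
  have hsum := hT.sum_bary x
  rw [← Finset.sum_erase T (f := fun v => bary T v x) hxz] at hsum
  exact (convex_convexHull ℝ _).sum_mem
    (fun w hw => hT.mem_convexHull.1 hx w (Finset.mem_of_mem_erase hw)) hsum
    fun w hw => subset_convexHull ℝ _ hw

theorem openFace_subset_convexHull_erase (hT : IsSimplex T) :
    openFace T z ⊆ convexHull ℝ (T.erase z : Set E) := fun x hx =>
  hT.mem_convexHull_erase (hT.mem_convexHull.2 fun w hw => by
    rcases eq_or_ne w z with rfl | hwz
    exacts [hx.1.ge, (hx.2 w hw hwz).le]) hx.1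

theorem exists_mem_openFace (hT : IsSimplex T) (hz : z ∈ T) (hne : (T.erase z).Nonempty) :
    ∃ x, x ∈ openFace T z := by
  obtain ⟨p, hp⟩ := hT.nonempty_interior
  rw [hT.mem_interior] at hp
  obtain ⟨v, hv⟩ := hne
  have hlt : bary T z p < 1 := by
    rw [← hT.sum_bary p]
    exact Finset.single_lt_sum (Finset.ne_of_mem_erase hv) hz (Finset.mem_of_mem_erase hv)
      (hp v (Finset.mem_of_mem_erase hv)) fun w hw _ => (hp w hw).le
  obtain ⟨x, hxz, hxw, -⟩ := hT.exists_eq_lineMap_of_bary_lt_one hz hlt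
  exact ⟨x, hxz, fun w hw hwz => by
    rw [hxw w hw hwz]
    exact mul_pos (inv_pos.2 (sub_pos.2 hlt)) (hp w hw)⟩

theorem convexHull_erase_subset_closure_openFace (hT : IsSimplex T) (hz : z ∈ T) :
    convexHull ℝ (T.erase z : Set E) ⊆ closure (openFace T z) := by
  intro x hx
  have hsub : (T.erase z : Set E) ⊆ T := Finset.coe_subset.2 (Finset.erase_subset z T)
  have hxz : bary T z x = 0 := hT.bary_eq_zero_of_mem_convexHull hz hsub (by simp) hx
  obtain ⟨b, hb⟩ := hT.exists_mem_openFace hz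
    (Finset.coe_nonempty.1 (convexHull_nonempty_iff.1 ⟨x, hx⟩))
  have hlim : Filter.Tendsto (fun t : ℝ => AffineMap.lineMap x b t) (nhdsWithin 0 (Ioi 0))
      (nhds x) := by
    have hcont : Continuous fun t : ℝ => AffineMap.lineMap x b t := AffineMap.lineMap_continuous
    simpa using (hcont.tendsto 0).mono_left nhdsWithin_le_nhds
  refine mem_closure_of_tendsto hlim ?_
  filter_upwards [Ioo_mem_nhdsGT (zero_lt_one (α := ℝ))] with t ht
  refine ⟨by rw [AffineMap.apply_lineMap, hxz, hb.1, AffineMap.lineMap_same_apply],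
    fun w hw hwz => ?_⟩
  rw [AffineMap.apply_lineMap, AffineMap.lineMap_apply_ring]
  have hxw := hT.mem_convexHull.1 (convexHull_mono hsub hx) w hw
  have hbw := hb.2 w hw hwz
  nlinarith [ht.1, ht.2]

theorem erase_eq_of_mem_openFace (hT : IsSimplex T) (hT' : IsSimplex T') (hz : z ∈ T)
    (hx : x ∈ openFace T z) (hx' : x ∈ convexHull ℝ ((T' : Set E) ∩ T)) :
    ∃ z' ∈ T', T'.erase z' = T.erase z := by
  have hsub : T.erase z ⊆ T' := fun w hw => by
    by_contra hwT'
    obtain ⟨hwz, hwT⟩ := Finset.mem_erase.1 hw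
    exact (hx.2 w hwT hwz).ne' (hT.bary_eq_zero_of_mem_convexHull hwT inter_subset_right
      (fun h => hwT' h.1) hx')
  have hcard : T'.card = (T.erase z).card + 1 := by
    rw [Finset.card_erase_add_one hz, hT.card_eq, hT'.card_eq]
  obtain ⟨z', hz', heq⟩ := Finset.exists_eq_insert_iff.2 ⟨hsub, hcard.symm⟩
  exact ⟨z', heq ▸ Finset.mem_insert_self _ _, by rw [← heq, Finset.erase_insert hz']⟩

theorem moveApex_of_mem_convexHull_erase (hT : IsSimplex T) (hz : z ∈ T)
    (hx : x ∈ convexHull ℝ (T.erase z : Set E)) : moveApex T z z' x = x := by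
  rw [moveApex_apply, hT.bary_eq_zero_of_mem_convexHull hz
    (Finset.coe_subset.2 (Finset.erase_subset z T)) (by simp) hx, zero_smul, add_zero]

theorem moveApex_image (hT : IsSimplex T) (hz : z ∈ T) (hz' : z' ∈ T')
    (h : T.erase z = T'.erase z') :
    moveApex T z z' '' convexHull ℝ (T : Set E) = convexHull ℝ (T' : Set E) := by
  rw [AffineMap.image_convexHull, ← Finset.insert_erase hz, ← Finset.insert_erase hz', ← h,
    Finset.coe_insert, Finset.coe_insert, image_insert_eq, Finset.insert_erase hz,
    hT.moveApex_self hz]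
  congr 2
  exact (image_congr fun w hw => hT.moveApex_of_mem_convexHull_erase hz
    (subset_convexHull ℝ _ hw)).trans (image_id _)

theorem bary_eq_mul_bary (hT : IsSimplex T) (hT' : IsSimplex T') (hz : z ∈ T) (hz' : z' ∈ T')
    (h : T.erase z = T'.erase z') (x : E) : bary T z x = bary T z z' * bary T' z' x := by
  have key : bary T z = bary T z z' • bary T' z' := hT'.affineMap_ext fun w hw => by
    change bary T z w = bary T z z' * bary T' z' w
    rcases eq_or_ne w z' with rfl | hwz
    · rw [hT'.bary_self hz', mul_one]
    · obtain ⟨hwT, hne⟩ := mem_and_ne_of_erase_eq h hw hwz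
      rw [hT'.bary_of_ne hz' hw hwz, hT.bary_of_ne hz hwT hne, mul_zero]
  exact DFunLike.congr_fun key x

theorem bary_apex_ne_zero (hT : IsSimplex T) (hT' : IsSimplex T') (hz : z ∈ T) (hz' : z' ∈ T')
    (h : T.erase z = T'.erase z') : bary T z z' ≠ 0 := fun h0 => by
  simpa [hT.bary_self hz, h0] using hT.bary_eq_mul_bary hT' hz hz' h z

theorem erase_nonempty_of_ne (hT : IsSimplex T) (hT' : IsSimplex T') (hz : z ∈ T)
    (hne : T ≠ T') : (T.erase z).Nonempty := by
  by_contra! hempty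
  have hrank : Module.finrank ℝ E = 0 := by
    have := Finset.card_erase_add_one hz
    rw [hempty, hT.card_eq] at this
    simpa using this.symm
  have := Module.finrank_zero_iff.1 hrank
  exact hne (Finset.eq_of_subset_of_card_le (fun w _ => by
    obtain ⟨v, hv⟩ := Finset.card_pos.1 (by rw [hT'.card_eq]; exact Nat.succ_pos _)
    rwa [Subsingleton.elim w v]) (by rw [hT.card_eq, hT'.card_eq]))

theorem bary_apex_neg (hT : IsSimplex T) (hT' : IsSimplex T') (hz : z ∈ T) (hz' : z' ∈ T')
    (h : T.erase z = T'.erase z') (hne : T ≠ T')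
    (hi : convexHull ℝ (T : Set E) ∩ convexHull ℝ (T' : Set E) ⊆
      convexHull ℝ ((T : Set E) ∩ T')) : bary T z z' < 0 := by
  by_contra! hnonneg
  have hpos : 0 < bary T z z' := hnonneg.lt_of_ne' (hT.bary_apex_ne_zero hT' hz hz' h)
  have hzT' : z ∉ T' := fun hzT' => by
    by_cases hzz' : z = z'
    · exact hne (by rw [← Finset.insert_erase hz, h, hzz', Finset.insert_erase hz'])
    · exact (mem_and_ne_of_erase_eq h hzT' hzz').2 rfl
  obtain ⟨b, hb⟩ := hT.exists_mem_openFace hz (hT.erase_nonempty_of_ne hT' hz hne)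
  have hbT' : b ∈ convexHull ℝ (T' : Set E) := by
    refine convexHull_mono ?_ (hT.openFace_subset_convexHull_erase hb)
    rw [h]
    exact Finset.coe_subset.2 (Finset.erase_subset z' T')
  obtain ⟨t, ht, ht0, ht1⟩ := ((hT.eventually_lineMap_mem_convexHull hb hnonneg).and
    (Ioo_mem_nhdsGT (zero_lt_one (α := ℝ)))).exists
  have hx := hT.bary_eq_zero_of_mem_convexHull hz inter_subset_left (fun h => hzT' h.2)
    (hi ⟨ht, (convex_convexHull ℝ _).lineMap_mem hbT' (subset_convexHull ℝ _ hz')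
      ⟨ht0.le, ht1.le⟩⟩)
  rw [AffineMap.apply_lineMap, hb.1, AffineMap.lineMap_apply_ring, mul_zero, zero_add] at hx
  exact (mul_pos ht0 hpos).ne' hx

theorem abs_le_mul_bary (hT : IsSimplex T) (hz : z ∈ T) {η : E → ℝ} {L : ℝ≥0}
    (hη : LipschitzOnWith L η (convexHull ℝ (T : Set E)))
    (h0 : ∀ x ∈ convexHull ℝ (T.erase z : Set E), η x = 0) {x : E}
    (hx : x ∈ convexHull ℝ (T : Set E)) (hx1 : bary T z x < 1) :
    |η x| ≤ L * Metric.diam (convexHull ℝ (T : Set E)) * bary T z x := by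
  have hx0 := hT.mem_convexHull.1 hx z hz
  obtain ⟨y, hyz, hyw, hxy⟩ := hT.exists_eq_lineMap_of_bary_lt_one hz hx1
  have hyT : y ∈ convexHull ℝ (T : Set E) := hT.mem_convexHull.2 fun w hw => by
    rcases eq_or_ne w z with rfl | hwz
    · exact hyz.ge
    · rw [hyw w hw hwz]
      exact mul_nonneg (inv_nonneg.2 (sub_pos.2 hx1).le) (hT.mem_convexHull.1 hx w hw)
  have hdist : dist x y ≤ Metric.diam (convexHull ℝ (T : Set E)) * bary T z x := by
    conv_lhs => rw [hxy]
    rw [dist_lineMap_left, Real.norm_eq_abs, abs_of_nonneg hx0, mul_comm]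
    gcongr
    exact Metric.dist_le_diam_of_mem (isCompact_convexHull_finset T).isBounded hyT
      (subset_convexHull ℝ _ hz)
  calc |η x| = dist (η x) (η y) := by
        rw [h0 y (hT.mem_convexHull_erase hyT hyz), Real.dist_eq, sub_zero]
    _ ≤ L * dist x y := hη.dist_le_mul x hx y hyT
    _ ≤ L * Metric.diam (convexHull ℝ (T : Set E)) * bary T z x := by rw [mul_assoc]; gcongr

end IsSimplex

end Simplex

section SimplexMeasure

variable {E : Type*} [NormedAddCommGroup E] [NormedSpace ℝ E] [MeasurableSpace E]
  (μ : Measure E) [μ.IsAddHaarMeasure]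

theorem IsSimplex.addHaar_real_pos [FiniteDimensional ℝ E] {T : Finset E} (hT : IsSimplex T) :
    0 < μ.real (convexHull ℝ (T : Set E)) :=
  ENNReal.toReal_pos (Measure.measure_pos_of_nonempty_interior _ hT.nonempty_interior).ne'
    (isCompact_convexHull_finset T).measure_lt_top.ne

variable [BorelSpace E]

/-- The outward flux of `x ↦ φ x • (x - z)` through the boundary of the simplex `T`, per unit of
volume, written as a volume integral by means of the divergence theorem. The field is tangential to
the faces containing `z`, so this is the mean of `φ` over the face opposite to `z`, up to a
dimensional factor. -/
def oppositeFaceFlux (T : Finset E) (z : E) (φ : E → ℝ) : ℝ :=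
  ⨍ x in convexHull ℝ (T : Set E), (Module.finrank ℝ E * φ x + fderiv ℝ φ x (x - z)) ∂μ

theorem oppositeFaceFlux_sub (T : Finset E) (z : E) {φ ψ : E → ℝ} (hφ : ContDiff ℝ 1 φ)
    (hψ : ContDiff ℝ 1 ψ) :
    oppositeFaceFlux μ T z (φ - ψ) = oppositeFaceFlux μ T z φ - oppositeFaceFlux μ T z ψ := by
  have hfi : ∀ {f : E → ℝ}, ContDiff ℝ 1 f → IntegrableOn
      (fun x => Module.finrank ℝ E * f x + fderiv ℝ f x (x - z)) (convexHull ℝ (T : Set E)) μ :=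
    fun hf => by
      have := hf.continuous
      have := hf.continuous_fderiv one_ne_zero
      exact (by fun_prop : Continuous _).continuousOn.integrableOn_compact
        (isCompact_convexHull_finset T)
  rw [oppositeFaceFlux, oppositeFaceFlux, oppositeFaceFlux, setAverage_eq, setAverage_eq,
    setAverage_eq, ← smul_sub, ← integral_sub (hfi hφ) (hfi hψ)]
  congr! 3 with x
  rw [fderiv_sub (hφ.differentiable one_ne_zero x) (hψ.differentiable one_ne_zero x)]
  simp only [Pi.sub_apply, sub_apply]
  ring

variable [FiniteDimensional ℝ E]

theorem addHaar_real_image_affineMap (A : E →ᵃ[ℝ] E) (K : Set E) :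
    μ.real (A '' K) = |LinearMap.det A.linear| * μ.real K := by
  have himage : A '' K = (fun x => x + A 0) '' (A.linear '' K) := by
    rw [image_image]
    exact image_congr fun x _ => by simpa using A.map_vadd 0 x
  rw [himage, Measure.real, image_add_right, measure_preimage_add_right,
    Measure.addHaar_image_linearMap, ENNReal.toReal_mul, ENNReal.toReal_ofReal (abs_nonneg _),
    Measure.real]

theorem setAverage_image_affineMap {A : E →ᵃ[ℝ] E} (hA : LinearMap.det A.linear ≠ 0) {K : Set E}
    (hK : MeasurableSet K) (f : E → ℝ) : ⨍ x in A '' K, f x ∂μ = ⨍ x in K, f (A x) ∂μ := by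
  have hinj : InjOn A K := fun x _ y _ h => by
    refine (LinearMap.equivOfDetNeZero A.linear hA).injective ?_
    change A.linear x = A.linear y
    rw [← sub_eq_zero, ← map_sub, ← vsub_eq_sub x y, AffineMap.linearMap_vsub, h, vsub_self]
  rw [setAverage_eq, setAverage_eq, addHaar_real_image_affineMap,
    integral_image_eq_integral_abs_det_fderiv_smul μ hK
      (fun x _ => (hasFDerivAt_affineMap A x).hasFDerivWithinAt) hinj, integral_smul,
    LinearMap.det_toContinuousLinearMap, smul_eq_mul, smul_eq_mul, smul_eq_mul, mul_inv]
  field_simp [abs_ne_zero.2 hA]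

namespace IsSimplex

variable {T T' : Finset E} {z z' : E}

theorem addHaar_convexHull_eq_zero (hT : IsSimplex T) (hz : z ∈ T) {F : Set E} (hFT : F ⊆ T)
    (hzF : z ∉ F) : μ (convexHull ℝ F) = 0 := by
  refine measure_mono_null (convexHull_subset_affineSpan F)
    (Measure.addHaar_affineSubspace μ _ fun htop => ?_)
  have himage : ((↑) : T → E) '' {w | ↑w ∈ F} = F := by
    ext w
    simpa using fun hw => hFT hw
  have hmem := hT.affineIndependent.mem_affineSpan_iff ⟨z, hz⟩ {w | ↑w ∈ F}
  rw [himage, htop] at hmem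
  exact hzF (hmem.1 (AffineSubspace.mem_top ℝ E z))

variable [DecidableEq E]

theorem addHaar_real_eq_abs_bary_mul (hT : IsSimplex T) (hz : z ∈ T) (hz' : z' ∈ T')
    (h : T.erase z = T'.erase z') :
    μ.real (convexHull ℝ (T' : Set E)) = |bary T z z'| * μ.real (convexHull ℝ (T : Set E)) := by
  rw [← hT.moveApex_image hz hz' h, addHaar_real_image_affineMap, hT.det_moveApex_linear hz]

theorem oppositeFaceFlux_eq_zero (hT : IsSimplex T) (hz : z ∈ T) {η : E → ℝ}
    (hη : ContDiff ℝ 1 η) (h0 : ∀ x ∈ convexHull ℝ (T.erase z : Set E), η x = 0) :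
    oppositeFaceFlux μ T z η = 0 := by
  have hK := isCompact_convexHull_finset T
  have hzK : z ∈ convexHull ℝ (T : Set E) := subset_convexHull ℝ _ hz
  obtain ⟨L, hL⟩ := hη.contDiffOn.exists_lipschitzOnWith one_ne_zero (convex_convexHull ℝ _) hK
  rw [oppositeFaceFlux, setAverage_eq, setIntegral_add_fderiv_eq_zero μ hK
    ((convex_convexHull ℝ _).starConvex hzK) hη
    (C := L * Metric.diam (convexHull ℝ (T : Set E)))
    (mul_nonneg L.coe_nonneg Metric.diam_nonneg) ?_, smul_zero]
  intro t ht x hx hxt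
  have hlt : bary T z x < 1 - t := by
    by_contra! hle
    refine hxt ⟨AffineMap.homothety z t⁻¹ x, hT.mem_convexHull.2 fun w hw => ?_, ?_⟩
    · have hxw := hT.mem_convexHull.1 hx w hw
      rw [AffineMap.homothety_eq_lineMap, AffineMap.apply_lineMap, AffineMap.lineMap_apply_ring]
      have hti := inv_pos.2 ht.1
      rcases eq_or_ne w z with rfl | hwz
      · rw [hT.bary_self hz]
        have := mul_inv_cancel₀ ht.1.ne'
        nlinarith
      · rw [hT.bary_of_ne hw hz hwz.symm, mul_zero, zero_add]
        exact mul_nonneg hti.le hxw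
    · rw [← AffineMap.homothety_mul_apply, mul_inv_cancel₀ ht.1.ne', AffineMap.homothety_one]
      rfl
  calc |η x| ≤ L * Metric.diam (convexHull ℝ (T : Set E)) * bary T z x :=
        hT.abs_le_mul_bary hz hL h0 hx (by linarith [ht.1])
    _ ≤ L * Metric.diam (convexHull ℝ (T : Set E)) * (1 - t) := by gcongr

theorem oppositeFaceFlux_comp_moveApex (hT : IsSimplex T) (hT' : IsSimplex T') (hz : z ∈ T)
    (hz' : z' ∈ T') (h : T.erase z = T'.erase z') {φ : E → ℝ} (hφ : Differentiable ℝ φ) :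
    oppositeFaceFlux μ T z (φ ∘ moveApex T z z') = oppositeFaceFlux μ T' z' φ := by
  rw [oppositeFaceFlux, oppositeFaceFlux, ← hT.moveApex_image hz hz' h, setAverage_image_affineMap μ
    (by rw [hT.det_moveApex_linear hz]; exact hT.bary_apex_ne_zero hT' hz hz' h)
    (isCompact_convexHull_finset T).measurableSet]
  congr! 3 with x
  rw [((hφ _).hasFDerivAt.comp x (hasFDerivAt_affineMap (moveApex T z z') x)).fderiv,
    ContinuousLinearMap.comp_apply, LinearMap.coe_toContinuousLinearMap', ← vsub_eq_sub x,
    AffineMap.linearMap_vsub, hT.moveApex_self hz, vsub_eq_sub]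

theorem oppositeFaceFlux_congr (hT : IsSimplex T) (hT' : IsSimplex T') (hz : z ∈ T) (hz' : z' ∈ T')
    (h : T.erase z = T'.erase z') {φ : E → ℝ} (hφ : ContDiff ℝ 1 φ) :
    oppositeFaceFlux μ T z φ = oppositeFaceFlux μ T' z' φ := by
  have hcomp : ContDiff ℝ 1 (φ ∘ moveApex T z z') := hφ.comp
    (⟨moveApex T z z', AffineMap.continuous_of_finiteDimensional _⟩ : E →ᴬ[ℝ] E).contDiff
  rw [← hT.oppositeFaceFlux_comp_moveApex μ hT' hz hz' h (hφ.differentiable one_ne_zero),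
    ← sub_eq_zero, ← oppositeFaceFlux_sub μ T z hφ hcomp]
  refine hT.oppositeFaceFlux_eq_zero μ hz (hφ.sub hcomp) fun x hx => ?_
  rw [Pi.sub_apply, Function.comp_apply, hT.moveApex_of_mem_convexHull_erase hz hx, sub_self]

end IsSimplex

end SimplexMeasure

section LipschitzBoundary

open scoped Pointwise in
theorem addHaar_eq_zero_of_add_smul_notMem {E : Type*} [NormedAddCommGroup E] [NormedSpace ℝ E]
    [FiniteDimensional ℝ E] [MeasurableSpace E] [BorelSpace E] (μ : Measure E) [μ.IsAddHaarMeasure]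
    {G : Set E} (hG : MeasurableSet G) {e : E}
    (h : ∀ x ∈ G, ∀ t : ℝ, t ≠ 0 → x + t • e ∉ G) : μ G = 0 := by
  have hbdd : Bornology.IsBounded (range fun n : ℕ => ((n : ℝ) + 1)⁻¹ • e) :=
    Metric.isBounded_range_of_tendsto _ ((tendsto_inv_atTop_zero.comp
      (Filter.tendsto_atTop_add_const_right _ 1 tendsto_natCast_atTop_atTop)).smul_const e)
  refine Measure.addHaar_eq_zero_of_disjoint_translates μ (fun n : ℕ => ((n : ℝ) + 1)⁻¹ • e)
    hbdd (fun m n hmn => disjoint_left.2 ?_) hG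
  rintro _ ⟨_, rfl, x, hx, rfl⟩ ⟨_, rfl, y, hy, hxy⟩
  refine h x hx (((m : ℝ) + 1)⁻¹ - ((n : ℝ) + 1)⁻¹)
    (sub_ne_zero.2 fun hinv => hmn (by simpa using hinv)) ?_
  convert hy
  rw [sub_smul, ← add_sub_assoc, sub_eq_iff_eq_add', add_comm x]
  exact hxy.symm

theorem addHaar_graph_eq_zero {F : Type*} [NormedAddCommGroup F] [InnerProductSpace ℝ F]
    [FiniteDimensional ℝ F] [MeasurableSpace F] [BorelSpace F] (μ : Measure F)
    [μ.IsAddHaarMeasure] {e : F} (he : ‖e‖ = 1) {γ : F → ℝ} (hγ : Continuous γ) :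
    μ {y | γ (y - inner ℝ e y • e) = inner ℝ e y} = 0 := by
  refine addHaar_eq_zero_of_add_smul_notMem μ
    (isClosed_eq (by fun_prop) (by fun_prop)).measurableSet (e := e) fun x hx t ht hxt => ht ?_
  have hee : inner ℝ e e = (1 : ℝ) := by rw [real_inner_self_eq_norm_sq, he, one_pow]
  rw [mem_ofPred_eq] at hx hxt
  rw [inner_add_right, inner_smul_right, hee, mul_one, add_smul, add_sub_add_right_eq_sub,
    hx] at hxt
  linarith

theorem HasLipschitzBoundary.volume_frontier {d : ℕ} {Ω : Set (Euc d)}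
    (hΩl : HasLipschitzBoundary Ω) (hΩo : IsOpen Ω) : volume (frontier Ω) = 0 := by
  refine measure_null_of_locally_null _ fun x hx => ?_
  obtain ⟨e, r, K, γ, he, hr, hγ, hepi⟩ := hΩl x hx
  have hγc := hγ.continuous
  refine ⟨frontier Ω ∩ Metric.ball x r, Filter.inter_mem self_mem_nhdsWithin
    (mem_nhdsWithin_of_mem_nhds (Metric.ball_mem_nhds x hr)),
    measure_mono_null ?_ (addHaar_graph_eq_zero volume he hγc)⟩
  rintro y ⟨hy, hyr⟩
  rw [hΩo.frontier_eq] at hy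
  refine le_antisymm (not_lt.1 fun hlt => ?_) (not_lt.1 fun hlt => hy.2 ((hepi y hyr).2 hlt))
  have hopen : IsOpen {y : Euc d | inner ℝ e y < γ (y - inner ℝ e y • e)} :=
    isOpen_lt (by fun_prop) (by fun_prop)
  obtain ⟨w, ⟨hwlt, hwr⟩, hwΩ⟩ := mem_closure_iff.1 hy.1 _
    (hopen.inter Metric.isOpen_ball) ⟨hlt, hyr⟩
  exact lt_asymm hwlt ((hepi w hwr).1 hwΩ)

end LipschitzBoundary

section Mesh

/-- A face of a cell, seen from that cell: the pair `⟨T, z⟩` stands for the face of the cell `T`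
opposite to its vertex `z`. -/
abbrev Side (d : ℕ) : Type := Σ _ : Finset (Euc d), Euc d

/-- The set of vertices of the face which a side stands for. -/
def Side.face {d : ℕ} (q : Side d) : Finset (Euc d) := q.1.erase q.2

namespace SimplicialMesh

variable {d : ℕ} {Ω : Set (Euc d)} {M : SimplicialMesh Ω} {S T : Finset (Euc d)} {q q' : Side d}

theorem isSimplex (M : SimplicialMesh Ω) (hT : T ∈ M.cells) : IsSimplex T :=
  ⟨by rw [finrank_euclideanSpace_fin, M.card_eq T hT], M.affineIndependent T hT⟩

theorem convexHull_subset_closure (M : SimplicialMesh Ω) (hT : T ∈ M.cells) :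
    convexHull ℝ (T : Set (Euc d)) ⊆ closure Ω :=
  (subset_biUnion_of_mem (u := fun T : Finset (Euc d) => convexHull ℝ (T : Set (Euc d))) hT).trans
    M.cover.subset

theorem exists_cell_of_mem (M : SimplicialMesh Ω) {x : Euc d} (hx : x ∈ closure Ω) :
    ∃ T ∈ M.cells, x ∈ convexHull ℝ (T : Set (Euc d)) := by
  simpa [← M.cover] using hx

theorem volume_inter_eq_zero (M : SimplicialMesh Ω) (hS : S ∈ M.cells) (hT : T ∈ M.cells)
    (hST : S ≠ T) :
    volume (convexHull ℝ (S : Set (Euc d)) ∩ convexHull ℝ (T : Set (Euc d))) = 0 := by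
  obtain ⟨z, hzS, hzT⟩ : ∃ z ∈ S, z ∉ T := by
    by_contra! hsub
    exact hST (Finset.eq_of_subset_of_card_le hsub (by rw [M.card_eq S hS, M.card_eq T hT]))
  exact measure_mono_null (M.inter_subset S hS T hT)
    ((M.isSimplex hS).addHaar_convexHull_eq_zero volume hzS inter_subset_left fun h => hzT h.2)

theorem restrict_convexHull_le (M : SimplicialMesh Ω) (h0 : volume (frontier Ω) = 0)
    (hT : T ∈ M.cells) : volume.restrict (convexHull ℝ (T : Set (Euc d))) ≤ volume.restrict Ω := by
  rw [Measure.restrict_congr_set (closure_ae_eq_of_null_frontier h0).symm]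
  exact Measure.restrict_mono (M.convexHull_subset_closure hT) le_rfl

theorem setIntegral_eq_sum (M : SimplicialMesh Ω) (h0 : volume (frontier Ω) = 0) {f : Euc d → ℝ}
    (hf : ∀ T ∈ M.cells, IntegrableOn f (convexHull ℝ (T : Set (Euc d)))) :
    ∫ x in Ω, f x = ∑ T ∈ M.cells, ∫ x in convexHull ℝ (T : Set (Euc d)), f x := by
  have hcover : ⋃ T : M.cells, convexHull ℝ ((T : Finset (Euc d)) : Set (Euc d)) = closure Ω := by
    rw [← M.cover, iUnion_subtype]
  have hdisjoint : Pairwise (Function.onFun (AEDisjoint volume)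
      fun T : M.cells => convexHull ℝ ((T : Finset (Euc d)) : Set (Euc d))) :=
    fun S T hST => M.volume_inter_eq_zero S.2 T.2 fun h => hST (Subtype.ext h)
  rw [setIntegral_congr_set (closure_ae_eq_of_null_frontier h0).symm, ← hcover,
    integral_iUnion_ae (fun T => (isCompact_convexHull_finset _).measurableSet.nullMeasurableSet)
      hdisjoint (integrableOn_finite_iUnion.2 fun T => hf T T.2), tsum_fintype,
    Finset.sum_coe_sort M.cells fun T => ∫ x in convexHull ℝ (T : Set (Euc d)), f x]

/-- The function which agrees with `f T` on each cell `T`; on the skeleton of the mesh, a null set,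
the values of the cells that meet there are added up. -/
def glue {B : Type*} [AddCommMonoid B] (M : SimplicialMesh Ω) (f : Finset (Euc d) → Euc d → B)
    (x : Euc d) : B :=
  ∑ T ∈ M.cells, (convexHull ℝ (T : Set (Euc d))).indicator (f T) x

theorem glue_ae_eq {B : Type*} [AddCommMonoid B] (M : SimplicialMesh Ω)
    (f : Finset (Euc d) → Euc d → B) (hT : T ∈ M.cells) :
    M.glue f =ᵐ[volume.restrict (convexHull ℝ (T : Set (Euc d)))] f T := by
  have hm := (isCompact_convexHull_finset T).measurableSet
  have hnotMem : ∀ᵐ x ∂volume.restrict (convexHull ℝ (T : Set (Euc d))),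
      ∀ S ∈ M.cells, S ≠ T → x ∉ convexHull ℝ (S : Set (Euc d)) := by
    rw [Filter.eventually_all_finset]
    intro S hS
    rw [Filter.eventually_imp_distrib_left]
    intro hST
    rw [ae_restrict_iff' hm]
    filter_upwards [compl_mem_ae_iff.2 (M.volume_inter_eq_zero hS hT hST)] with x hx hxT hxS
    exact hx ⟨hxS, hxT⟩
  filter_upwards [hnotMem, ae_restrict_mem hm] with x hx hxT
  rw [glue, Finset.sum_eq_single T (fun S hS hST => indicator_of_notMem (hx S hS hST) _)
    (fun h => absurd hT h), indicator_of_mem hxT]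

theorem memLp_glue {B : Type*} [NormedAddCommGroup B] (M : SimplicialMesh Ω)
    {f : Finset (Euc d) → Euc d → B} (hf : ∀ T ∈ M.cells, Continuous (f T)) :
    MemLp (M.glue f) 2 (volume.restrict Ω) := by
  refine MemLp.restrict _ (memLp_finsetSum _ fun S hS => ?_)
  have hK := isCompact_convexHull_finset S
  rw [memLp_indicator_iff_restrict hK.measurableSet]
  have : IsFiniteMeasure (volume.restrict (convexHull ℝ (S : Set (Euc d)))) :=
    ⟨by simpa using hK.measure_lt_top⟩
  obtain ⟨C, hC⟩ := hK.exists_bound_of_continuousOn (hf S hS).continuousOn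
  refine MemLp.of_bound (hf S hS).aestronglyMeasurable C ?_
  filter_upwards [ae_restrict_mem hK.measurableSet] with x hx using hC x hx

/-- The sides of all cells. A face in the interior of `Ω` is counted twice, once for each of the two
cells which share it. -/
def sides (M : SimplicialMesh Ω) : Finset (Side d) := M.cells.sigma fun T => T

theorem mem_sides : q ∈ M.sides ↔ q.1 ∈ M.cells ∧ q.2 ∈ q.1 := Finset.mem_sigma

theorem sum_sides (M : SimplicialMesh Ω) (f : Side d → ℝ) :
    ∑ q ∈ M.sides, f q = ∑ T ∈ M.cells, ∑ z ∈ T, f ⟨T, z⟩ := Finset.sum_sigma _ _ _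

/-- The sides which stand for the face with vertex set `F`: one or two of them. -/
def fiber (M : SimplicialMesh Ω) (F : Finset (Euc d)) : Finset (Side d) :=
  M.sides.filter fun q => q.face = F

theorem mem_fiber {F : Finset (Euc d)} : q ∈ M.fiber F ↔ q ∈ M.sides ∧ q.face = F :=
  Finset.mem_filter

theorem fst_ne_of_face_eq (hq : q ∈ M.sides) (h : q.face = q'.face) (hne : q ≠ q') :
    q.1 ≠ q'.1 := by
  obtain ⟨T, z⟩ := q
  obtain ⟨T', z'⟩ := q'
  rintro rfl
  exact hne (congrArg (Sigma.mk T) ((Finset.erase_inj T (mem_sides.1 hq).2).1 h))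

theorem bary_neg_of_face_eq (hq : q ∈ M.sides) (hq' : q' ∈ M.sides) (h : q.face = q'.face)
    (hne : q ≠ q') : bary q.1 q.2 q'.2 < 0 :=
  have ⟨hT, hz⟩ := mem_sides.1 hq
  have ⟨hT', hz'⟩ := mem_sides.1 hq'
  (M.isSimplex hT).bary_apex_neg (M.isSimplex hT') hz hz' h (fst_ne_of_face_eq hq h hne)
    (M.inter_subset _ hT _ hT')

theorem fiber_eq_pair (hq : q ∈ M.sides) (hq' : q' ∈ M.sides) (h : q.face = q'.face)
    (hne : q ≠ q') : M.fiber q.face = {q, q'} := by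
  ext t
  rw [mem_fiber, Finset.mem_insert, Finset.mem_singleton]
  refine ⟨fun ⟨ht, htq⟩ => ?_, ?_⟩
  · -- The apices of distinct cells at a face lie on opposite sides of it, pairwise.
    by_contra! htne
    have hqt := bary_neg_of_face_eq hq ht htq.symm htne.1.symm
    have hqq' := bary_neg_of_face_eq hq hq' h hne
    have hq't := bary_neg_of_face_eq hq' ht (h.symm.trans htq.symm) htne.2.symm
    have hmul := (M.isSimplex (mem_sides.1 hq).1).bary_eq_mul_bary
      (M.isSimplex (mem_sides.1 hq').1) (mem_sides.1 hq).2 (mem_sides.1 hq').2 h t.2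
    linarith [mul_pos_of_neg_of_neg hqq' hq't]
  · rintro (rfl | rfl)
    exacts [⟨hq, rfl⟩, ⟨hq', h.symm⟩]

theorem fiber_eq_singleton_or_pair (hq : q ∈ M.sides) : M.fiber q.face = {q} ∨
    ∃ q' ∈ M.sides, q.face = q'.face ∧ q ≠ q' ∧ M.fiber q.face = {q, q'} := by
  by_cases h : ∃ q' ∈ M.sides, q.face = q'.face ∧ q ≠ q'
  · obtain ⟨q', hq', hf, hne⟩ := h
    exact Or.inr ⟨q', hq', hf, hne, fiber_eq_pair hq hq' hf hne⟩
  · push Not at h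
    refine Or.inl (Finset.eq_singleton_iff_unique_mem.2 ⟨mem_fiber.2 ⟨hq, rfl⟩, fun t ht => ?_⟩)
    exact (h t (mem_fiber.1 ht).1 (mem_fiber.1 ht).2.symm).symm

theorem sum_sides_le_sum_sides {f g : Side d → ℝ}
    (hsingle : ∀ q ∈ M.sides, M.fiber q.face = {q} → f q ≤ g q)
    (hpair : ∀ q ∈ M.sides, ∀ q' ∈ M.sides, q.face = q'.face → q ≠ q' →
      f q + f q' ≤ g q + g q') :
    ∑ q ∈ M.sides, f q ≤ ∑ q ∈ M.sides, g q := by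
  have hmaps : ∀ q ∈ M.sides, q.face ∈ M.sides.image Side.face :=
    fun q hq => Finset.mem_image_of_mem _ hq
  rw [← Finset.sum_fiberwise_of_maps_to hmaps f, ← Finset.sum_fiberwise_of_maps_to hmaps g]
  refine Finset.sum_le_sum fun F hF => ?_
  obtain ⟨q, hq, rfl⟩ := Finset.mem_image.1 hF
  change ∑ t ∈ M.fiber q.face, f t ≤ ∑ t ∈ M.fiber q.face, g t
  rcases fiber_eq_singleton_or_pair hq with h | ⟨q', hq', hf, hne, h⟩
  · rw [h, Finset.sum_singleton, Finset.sum_singleton]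
    exact hsingle q hq h
  · rw [h, Finset.sum_pair hne, Finset.sum_pair hne]
    exact hpair q hq q' hq' hf hne

theorem exists_cell_ne_of_mem_openFace (hΩo : IsOpen Ω) {x : Euc d} (hq : q ∈ M.sides)
    (hx : x ∈ openFace q.1 q.2) (hxΩ : x ∈ Ω) :
    ∃ S ∈ M.cells, S ≠ q.1 ∧ x ∈ convexHull ℝ (S : Set (Euc d)) := by
  obtain ⟨T, z⟩ := q
  obtain ⟨hT, hz⟩ := mem_sides.1 hq
  have hclosed : IsClosed (⋃ S ∈ M.cells.erase T, convexHull ℝ (S : Set (Euc d))) :=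
    isClosed_biUnion_finset fun S _ => (isCompact_convexHull_finset S).isClosed
  have hlim : Filter.Tendsto (fun t : ℝ => AffineMap.lineMap x z (-t))
      (nhdsWithin 0 (Ioi 0)) (nhds x) := by
    have hcont : Continuous fun t : ℝ => AffineMap.lineMap x z (-t) :=
      AffineMap.lineMap_continuous.comp continuous_neg
    simpa using (hcont.tendsto 0).mono_left nhdsWithin_le_nhds
  have hmem : x ∈ ⋃ S ∈ M.cells.erase T, convexHull ℝ (S : Set (Euc d)) := by
    refine hclosed.mem_of_tendsto hlim ?_
    filter_upwards [hlim.eventually (hΩo.mem_nhds hxΩ), self_mem_nhdsWithin] with t ht ht0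
    obtain ⟨S, hS, hxS⟩ := M.exists_cell_of_mem (subset_closure ht)
    refine mem_biUnion (Finset.mem_erase.2 ⟨?_, hS⟩) hxS
    rintro rfl
    have hbary := (M.isSimplex hT).mem_convexHull.1 hxS z hz
    rw [AffineMap.apply_lineMap, hx.1, (M.isSimplex hT).bary_self hz,
      AffineMap.lineMap_apply_ring] at hbary
    linarith [mem_Ioi.1 ht0]
  simpa [and_assoc, and_comm, and_left_comm] using hmem

theorem exists_side_ne_of_mem_openFace (hΩo : IsOpen Ω) {x : Euc d} (hq : q ∈ M.sides)
    (hx : x ∈ openFace q.1 q.2) (hxΩ : x ∈ Ω) : ∃ q' ∈ M.sides, q'.face = q.face ∧ q' ≠ q := by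
  obtain ⟨hT, hz⟩ := mem_sides.1 hq
  have hTs := M.isSimplex hT
  obtain ⟨S, hS, hne, hxS⟩ := exists_cell_ne_of_mem_openFace hΩo hq hx hxΩ
  have hxT : x ∈ convexHull ℝ (q.1 : Set (Euc d)) :=
    convexHull_mono (Finset.coe_subset.2 (Finset.erase_subset _ _))
      (hTs.openFace_subset_convexHull_erase hx)
  obtain ⟨z', hz', hface⟩ := hTs.erase_eq_of_mem_openFace (M.isSimplex hS) hz hx
    (M.inter_subset S hS _ hT ⟨hxS, hxT⟩)
  exact ⟨⟨S, z'⟩, mem_sides.2 ⟨hS, hz'⟩, hface, fun h => hne (congrArg Sigma.fst h)⟩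

theorem eq_zero_of_mem_convexHull_face (hΩo : IsOpen Ω) (hq : q ∈ M.sides)
    (hfiber : M.fiber q.face = {q}) {φ : Euc d → ℝ} (hφ : Continuous φ) (hφΩ : tsupport φ ⊆ Ω)
    {x : Euc d} (hx : x ∈ convexHull ℝ (q.face : Set (Euc d))) : φ x = 0 := by
  obtain ⟨hT, hz⟩ := mem_sides.1 hq
  refine closure_minimal (t := φ ⁻¹' {0}) (fun y hy => ?_) (isClosed_singleton.preimage hφ)
    ((M.isSimplex hT).convexHull_erase_subset_closure_openFace hz hx)
  refine image_eq_zero_of_notMem_tsupport fun hyφ => ?_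
  obtain ⟨q', hq', hface, hne⟩ := exists_side_ne_of_mem_openFace hΩo hq hy (hφΩ hyφ)
  have hmem : q' ∈ M.fiber q.face := mem_fiber.2 ⟨hq', hface⟩
  exact hne (Finset.mem_singleton.1 (hfiber ▸ hmem))

end SimplicialMesh

end Mesh

section RaviartThomas

namespace SimplicialMesh

variable {d : ℕ} {Ω : Set (Euc d)} {M : SimplicialMesh Ω} {T : Finset (Euc d)} {α : Side d → ℝ}

theorem ae_convexHull_of_ae (M : SimplicialMesh Ω) (h0 : volume (frontier Ω) = 0)
    (hT : T ∈ M.cells) {P : Euc d → Prop} (h : ∀ᵐ x ∂volume.restrict Ω, P x) :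
    ∀ᵐ x ∂volume.restrict (convexHull ℝ (T : Set (Euc d))), P x :=
  ae_mono (M.restrict_convexHull_le h0 hT) h

theorem ae_imp_of_ae_convexHull {P : Euc d → Prop}
    (h : ∀ᵐ x ∂volume.restrict (convexHull ℝ (T : Set (Euc d))), P x) :
    ∀ᵐ x ∂volume.restrict Ω, x ∈ convexHull ℝ (T : Set (Euc d)) → P x :=
  ae_restrict_of_ae ((ae_restrict_iff' (isCompact_convexHull_finset T).measurableSet).1 h)

theorem toLp_glue_ae_eq {B : Type*} [NormedAddCommGroup B] (M : SimplicialMesh Ω)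
    (h0 : volume (frontier Ω) = 0) {f : Finset (Euc d) → Euc d → B}
    (hf : ∀ T ∈ M.cells, Continuous (f T)) (hT : T ∈ M.cells) :
    (M.memLp_glue hf).toLp =ᵐ[volume.restrict (convexHull ℝ (T : Set (Euc d)))] f T := by
  filter_upwards [M.ae_convexHull_of_ae h0 hT (M.memLp_glue hf).coeFn_toLp,
    M.glue_ae_eq f hT] with x hx hxT using hx.trans hxT

theorem setIntegral_eq_sum_of_ae_eq (M : SimplicialMesh Ω) (h0 : volume (frontier Ω) = 0)
    {f : Euc d → ℝ} {g : Finset (Euc d) → Euc d → ℝ} (hg : ∀ T ∈ M.cells, Continuous (g T))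
    (hfg : ∀ T ∈ M.cells, f =ᵐ[volume.restrict (convexHull ℝ (T : Set (Euc d)))] g T) :
    ∫ x in Ω, f x = ∑ T ∈ M.cells, ∫ x in convexHull ℝ (T : Set (Euc d)), g T x := by
  rw [M.setIntegral_eq_sum h0 fun T hT => ((hg T hT).continuousOn.integrableOn_compact
    (isCompact_convexHull_finset T)).congr_fun_ae (hfg T hT).symm]
  exact Finset.sum_congr rfl fun T hT => integral_congr_ae (hfg T hT)

theorem exists_ae_eq_const_of_mem_Wh (h0 : volume (frontier Ω) = 0) {w : L2Scal Ω}
    (hw : w ∈ M.Wh) : ∃ p : Finset (Euc d) → ℝ, ∀ T ∈ M.cells,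
      w =ᵐ[volume.restrict (convexHull ℝ (T : Set (Euc d)))] fun _ => p T := by
  choose! p hp using hw
  refine ⟨p, fun T hT => ?_⟩
  filter_upwards [M.ae_convexHull_of_ae h0 hT (hp T hT),
    ae_restrict_mem (isCompact_convexHull_finset T).measurableSet] with x hx hxT using hx hxT

/-- Prescribed fluxes through the sides of the cells are conservative if what leaves one cell
through a face enters the other one. -/
def IsConservative (M : SimplicialMesh Ω) (α : Side d → ℝ) : Prop :=
  ∀ q ∈ M.sides, ∀ q' ∈ M.sides, q.face = q'.face → q ≠ q' → α q + α q' = 0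

/-- The lowest order Raviart-Thomas field on the cell `T` with prescribed fluxes: its flux through
the face of `T` opposite to `z` is `d * α ⟨T, z⟩`, as `x ↦ x - z` is tangential to all other
faces. -/
def rtField (α : Side d → ℝ) (T : Finset (Euc d)) (x : Euc d) : Euc d :=
  ∑ z ∈ T, (α ⟨T, z⟩ / volume.real (convexHull ℝ (T : Set (Euc d)))) • (x - z)

/-- The divergence of `rtField α T`. -/
def rtDiv (α : Side d → ℝ) (T : Finset (Euc d)) : ℝ :=
  d * (∑ z ∈ T, α ⟨T, z⟩) / volume.real (convexHull ℝ (T : Set (Euc d)))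

theorem continuous_rtField (α : Side d → ℝ) (T : Finset (Euc d)) : Continuous (rtField α T) := by
  unfold rtField
  fun_prop

theorem sum_mul_oppositeFaceFlux_eq_zero (hΩo : IsOpen Ω) (hα : M.IsConservative α)
    {φ : Euc d → ℝ} (hφ : ContDiff ℝ 1 φ) (hφΩ : tsupport φ ⊆ Ω) :
    ∑ q ∈ M.sides, α q * oppositeFaceFlux volume q.1 q.2 φ = 0 := by
  have hsingle : ∀ q ∈ M.sides, M.fiber q.face = {q} →
      α q * oppositeFaceFlux volume q.1 q.2 φ = 0 := fun q hq hfiber => by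
    obtain ⟨hT, hz⟩ := mem_sides.1 hq
    rw [(M.isSimplex hT).oppositeFaceFlux_eq_zero volume hz hφ fun x hx =>
      eq_zero_of_mem_convexHull_face hΩo hq hfiber hφ.continuous hφΩ hx, mul_zero]
  have hpair : ∀ q ∈ M.sides, ∀ q' ∈ M.sides, q.face = q'.face → q ≠ q' →
      α q * oppositeFaceFlux volume q.1 q.2 φ + α q' * oppositeFaceFlux volume q'.1 q'.2 φ = 0 :=
    fun q hq q' hq' hf hne => by
      obtain ⟨hT, hz⟩ := mem_sides.1 hq
      obtain ⟨hT', hz'⟩ := mem_sides.1 hq'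
      rw [(M.isSimplex hT).oppositeFaceFlux_congr volume (M.isSimplex hT') hz hz' hf hφ, ← add_mul,
        hα q hq q' hq' hf hne, zero_mul]
  refine le_antisymm ?_ ?_
  · refine (sum_sides_le_sum_sides (g := fun _ => 0) (fun q hq h => (hsingle q hq h).le)
      fun q hq q' hq' hf hne => ?_).trans_eq Finset.sum_const_zero
    rw [hpair q hq q' hq' hf hne, add_zero]
  · refine Finset.sum_const_zero.symm.trans_le (sum_sides_le_sum_sides (f := fun _ => 0)
      (fun q hq h => (hsingle q hq h).ge) fun q hq q' hq' hf hne => ?_)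
    rw [hpair q hq q' hq' hf hne, add_zero]

theorem setIntegral_inner_rtField_gradient (α : Side d → ℝ) (T : Finset (Euc d)) {φ : Euc d → ℝ}
    (hφ : ContDiff ℝ 1 φ) :
    ∫ x in convexHull ℝ (T : Set (Euc d)), inner ℝ (rtField α T x) (gradient φ x) =
      ∑ z ∈ T, α ⟨T, z⟩ * oppositeFaceFlux volume T z φ -
        ∫ x in convexHull ℝ (T : Set (Euc d)), rtDiv α T * φ x := by
  have hfi : ∀ {f : Euc d → ℝ}, Continuous f → IntegrableOn f (convexHull ℝ (T : Set (Euc d))) :=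
    fun hf => hf.continuousOn.integrableOn_compact (isCompact_convexHull_finset T)
  have hcont := hφ.continuous
  simp only [rtField, inner_gradient_right, RCLike.conj_to_real, map_sum, map_smul, smul_eq_mul]
  rw [integral_finsetSum _ fun z _ => hfi (by fun_prop), integral_const_mul, rtDiv, Finset.mul_sum,
    Finset.sum_div, Finset.sum_mul, ← Finset.sum_sub_distrib]
  refine Finset.sum_congr rfl fun z _ => ?_
  rw [integral_const_mul, oppositeFaceFlux, setAverage_eq, integral_add (hfi (by fun_prop))
    (hfi (by fun_prop)), integral_const_mul, finrank_euclideanSpace_fin, smul_eq_mul]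
  ring

theorem hasWeakDiv_toLp_glue_rtField (hΩo : IsOpen Ω) (h0 : volume (frontier Ω) = 0)
    (hα : M.IsConservative α) :
    HasWeakDiv Ω (M.memLp_glue fun T _ => continuous_rtField α T).toLp
      (M.memLp_glue (f := fun T _ => rtDiv α T) fun _ _ => continuous_const).toLp := by
  intro φ hφ _ hφΩ
  have hφ1 : ContDiff ℝ 1 φ := hφ.of_le (by exact_mod_cast le_top)
  have hcont := hφ1.continuous
  have hgrad : Continuous (gradient φ) :=
    (LinearIsometryEquiv.continuous _).comp (hφ1.continuous_fderiv one_ne_zero)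
  rw [M.setIntegral_eq_sum_of_ae_eq h0 (g := fun T x => inner ℝ (rtField α T x) (gradient φ x))
      (fun T _ => (continuous_rtField α T).inner hgrad) fun T hT => by
        filter_upwards [M.toLp_glue_ae_eq h0 (fun T _ => continuous_rtField α T) hT] with x hx
        rw [hx],
    M.setIntegral_eq_sum_of_ae_eq h0 (g := fun T x => rtDiv α T * φ x)
      (fun T _ => by fun_prop) fun T hT => by
        filter_upwards [M.toLp_glue_ae_eq h0 (f := fun T _ => rtDiv α T)
          (fun _ _ => continuous_const) hT] with x hx
        rw [hx],
    Finset.sum_congr rfl fun T _ => setIntegral_inner_rtField_gradient α T hφ1,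
    Finset.sum_sub_distrib, ← M.sum_sides fun q => α q * oppositeFaceFlux volume q.1 q.2 φ,
    sum_mul_oppositeFaceFlux_eq_zero hΩo hα hφ1 hφΩ, zero_sub]

theorem exists_mem_Vh_of_isConservative (hΩo : IsOpen Ω) (h0 : volume (frontier Ω) = 0)
    (hα : M.IsConservative α) : ∃ v ∈ M.Vh, ∀ T ∈ M.cells,
      v.toL2 =ᵐ[volume.restrict (convexHull ℝ (T : Set (Euc d)))] rtField α T ∧
        v.div =ᵐ[volume.restrict (convexHull ℝ (T : Set (Euc d)))] fun _ => rtDiv α T := by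
  have hweak := hasWeakDiv_toLp_glue_rtField hΩo h0 hα
  have hrt : ∀ T ∈ M.cells, (M.memLp_glue fun T _ => continuous_rtField α T).toLp
      =ᵐ[volume.restrict (convexHull ℝ (T : Set (Euc d)))] rtField α T :=
    fun T hT => M.toLp_glue_ae_eq h0 (fun T _ => continuous_rtField α T) hT
  refine ⟨⟨_, _, hweak⟩, fun T hT => ?_, fun T hT => ⟨hrt T hT, ?_⟩⟩
  · refine ⟨-∑ z ∈ T, (α ⟨T, z⟩ / volume.real (convexHull ℝ (T : Set (Euc d)))) • z,
      ∑ z ∈ T, α ⟨T, z⟩ / volume.real (convexHull ℝ (T : Set (Euc d))), ?_⟩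
    filter_upwards [ae_imp_of_ae_convexHull (hrt T hT)] with x hx hxT
    refine (hx hxT).trans ?_
    rw [rtField, Finset.sum_smul, neg_add_eq_sub, ← Finset.sum_sub_distrib]
    exact Finset.sum_congr rfl fun z _ => smul_sub _ _ _
  · rw [Hdiv.div_eq_of_hasWeakDiv hΩo ⟨_, _, hweak⟩ _ hweak]
    exact M.toLp_glue_ae_eq h0 (fun _ _ => continuous_const) hT

end SimplicialMesh

end RaviartThomas

section InfSup

theorem norm_sq_eq_integral {X F : Type*} [MeasurableSpace X] [NormedAddCommGroup F]
    [InnerProductSpace ℝ F] {μ : Measure X} (f : Lp F 2 μ) : ‖f‖ ^ 2 = ∫ x, ‖f x‖ ^ 2 ∂μ := by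
  rw [← real_inner_self_eq_norm_sq, L2.inner_def]
  simp only [real_inner_self_eq_norm_sq]

theorem mul_sq_sub_sq_le {c p p' R R' V V' κ L : ℝ} (hκ : 0 < κ) (hR : 0 < R) (hR' : 0 ≤ R')
    (hV : c ^ 2 * R ≤ κ * V) (hV' : c ^ 2 * R' ≤ κ * V') (hL : (c * (R + R')) ^ 2 ≤ κ * L) :
    c * (p ^ 2 - p' ^ 2) ≤
      (4 * κ + L / 8) * ((p - p') ^ 2 / (R + R')) + (p ^ 2 * V + p' ^ 2 * V') / 2 := by
  obtain ⟨ρ, hρ⟩ : ∃ ρ, ρ = R + R' := ⟨_, rfl⟩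
  obtain ⟨t, ht⟩ : ∃ t, t = (p - p') / ρ := ⟨_, rfl⟩
  have hρ0 : 0 < ρ := by linarith
  have hp : p - p' = t * ρ := by rw [ht, div_mul_cancel₀ _ hρ0.ne']
  have hsq : (p - p') ^ 2 / ρ = t ^ 2 * ρ := by rw [hp]; field_simp
  have hyoung : 16 * κ * (c * (p ^ 2 - p' ^ 2)) ≤
      64 * κ ^ 2 * (t ^ 2 * ρ) + ρ * (c * (p + p')) ^ 2 := by
    have hfactor : p ^ 2 - p' ^ 2 = t * ρ * (p + p') := by rw [← hp]; ring
    rw [hfactor]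
    linarith [mul_nonneg hρ0.le (sq_nonneg (8 * κ * t - c * (p + p')))]
  have hleft : c ^ 2 * R * (p + p') ^ 2 ≤ c ^ 2 * R * (8 * p ^ 2 + 2 * (t * ρ) ^ 2) := by
    refine mul_le_mul_of_nonneg_left ?_ (by positivity)
    rw [← hp]
    linarith [sq_nonneg (3 * p - p')]
  have hright : c ^ 2 * R' * (p + p') ^ 2 ≤ c ^ 2 * R' * (8 * p' ^ 2 + 2 * (t * ρ) ^ 2) := by
    refine mul_le_mul_of_nonneg_left ?_ (by positivity)
    rw [← hp]
    linarith [sq_nonneg (3 * p' - p)]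
  have hsplit : ρ * (c * (p + p')) ^ 2 ≤
      8 * κ * (p ^ 2 * V + p' ^ 2 * V') + 2 * (κ * L) * (t ^ 2 * ρ) := by
    rw [← hρ] at hL
    have hρc : ρ * (c * (p + p')) ^ 2 =
      c ^ 2 * R * (p + p') ^ 2 + c ^ 2 * R' * (p + p') ^ 2 := by rw [hρ]; ring
    have hρt : (c ^ 2 * R + c ^ 2 * R') * (t * ρ) ^ 2 = (c * ρ) ^ 2 * (t ^ 2 * ρ) := by
      rw [hρ]; ring
    linarith [mul_le_mul_of_nonneg_right hV (sq_nonneg p),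
      mul_le_mul_of_nonneg_right hV' (sq_nonneg p'),
      mul_le_mul_of_nonneg_right hL (mul_nonneg (sq_nonneg t) hρ0.le)]
  rw [← hρ, hsq]
  refine le_of_mul_le_mul_left ?_ (by positivity : (0 : ℝ) < 16 * κ)
  linarith

namespace SimplicialMesh

variable {d : ℕ} {Ω : Set (Euc d)} {M : SimplicialMesh Ω} {T : Finset (Euc d)} {q q' : Side d}

/-- The ratio of `diam² T` to the volume of the simplex `T`. -/
def cellWeight (T : Finset (Euc d)) : ℝ :=
  Metric.diam (convexHull ℝ (T : Set (Euc d))) ^ 2 / volume.real (convexHull ℝ (T : Set (Euc d)))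

/-- The sum of the weights of the cells at the face with vertex set `F`. -/
def faceWeight (M : SimplicialMesh Ω) (F : Finset (Euc d)) : ℝ :=
  ∑ q ∈ M.fiber F, cellWeight q.1

/-- The jump across a side of a piecewise constant function with cell values `p`, extended by zero
outside of `Ω`. The sum contains `p q.1` once or, at an interior face, with the value beyond it. -/
def jump (M : SimplicialMesh Ω) (p : Finset (Euc d) → ℝ) (q : Side d) : ℝ :=
  2 * p q.1 - ∑ q' ∈ M.fiber q.face, p q'.1

/-- The fluxes which are proportional to the jumps of a piecewise constant function: a discrete
gradient. -/
def jumpFlux (M : SimplicialMesh Ω) (p : Finset (Euc d) → ℝ) (q : Side d) : ℝ :=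
  M.jump p q / M.faceWeight q.face

/-- The squared discrete energy norm of a piecewise constant function with cell values `p`. -/
def jumpEnergy (M : SimplicialMesh Ω) (p : Finset (Euc d) → ℝ) : ℝ :=
  ∑ q ∈ M.sides, M.jump p q ^ 2 / M.faceWeight q.face

theorem volume_real_pos (M : SimplicialMesh Ω) (hT : T ∈ M.cells) :
    0 < volume.real (convexHull ℝ (T : Set (Euc d))) :=
  (M.isSimplex hT).addHaar_real_pos volume

theorem diam_pos (hd : 1 ≤ d) (hT : T ∈ M.cells) :
    0 < Metric.diam (convexHull ℝ (T : Set (Euc d))) := by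
  obtain ⟨z, hz, w, hw, hzw⟩ := Finset.one_lt_card.1 (by rw [M.card_eq T hT]; lia : 1 < T.card)
  exact (dist_pos.2 hzw).trans_le (Metric.dist_le_diam_of_mem
    (isCompact_convexHull_finset T).isBounded (subset_convexHull ℝ _ hz)
    (subset_convexHull ℝ _ hw))

theorem cellWeight_pos (hd : 1 ≤ d) (hT : T ∈ M.cells) : 0 < cellWeight T :=
  div_pos (pow_pos (diam_pos hd hT) 2) (M.volume_real_pos hT)

theorem cellWeight_le_faceWeight (hq : q ∈ M.sides) : cellWeight q.1 ≤ M.faceWeight q.face :=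
  Finset.single_le_sum (f := fun q : Side d => cellWeight q.1)
    (fun _ _ => div_nonneg (sq_nonneg _) measureReal_nonneg) (mem_fiber.2 ⟨hq, rfl⟩)

theorem faceWeight_pos (hd : 1 ≤ d) (hq : q ∈ M.sides) : 0 < M.faceWeight q.face :=
  (cellWeight_pos hd (mem_sides.1 hq).1).trans_le (cellWeight_le_faceWeight hq)

theorem faceWeight_of_singleton (h : M.fiber q.face = {q}) :
    M.faceWeight q.face = cellWeight q.1 := by rw [faceWeight, h, Finset.sum_singleton]

theorem faceWeight_of_pair (hq : q ∈ M.sides) (hq' : q' ∈ M.sides) (h : q.face = q'.face)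
    (hne : q ≠ q') : M.faceWeight q.face = cellWeight q.1 + cellWeight q'.1 := by
  rw [faceWeight, fiber_eq_pair hq hq' h hne, Finset.sum_pair hne]

theorem jump_of_singleton (p : Finset (Euc d) → ℝ) (h : M.fiber q.face = {q}) :
    M.jump p q = p q.1 := by
  rw [jump, h, Finset.sum_singleton]
  ring

theorem jump_of_pair (p : Finset (Euc d) → ℝ) (hq : q ∈ M.sides) (hq' : q' ∈ M.sides)
    (h : q.face = q'.face) (hne : q ≠ q') : M.jump p q = p q.1 - p q'.1 := by
  rw [jump, fiber_eq_pair hq hq' h hne, Finset.sum_pair hne]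
  ring

theorem isConservative_jumpFlux (M : SimplicialMesh Ω) (p : Finset (Euc d) → ℝ) :
    M.IsConservative (M.jumpFlux p) := by
  intro q hq q' hq' h hne
  rw [jumpFlux, jumpFlux, ← h, jump_of_pair p hq hq' h hne, jump_of_pair p hq' hq h.symm hne.symm]
  ring

theorem jump_sq_div_faceWeight_nonneg (p : Finset (Euc d) → ℝ) (q : Side d) :
    0 ≤ M.jump p q ^ 2 / M.faceWeight q.face :=
  div_nonneg (sq_nonneg _)
    (Finset.sum_nonneg fun _ _ => div_nonneg (sq_nonneg _) measureReal_nonneg)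

theorem jumpEnergy_nonneg (M : SimplicialMesh Ω) (p : Finset (Euc d) → ℝ) : 0 ≤ M.jumpEnergy p :=
  Finset.sum_nonneg fun q _ => jump_sq_div_faceWeight_nonneg p q

theorem jumpEnergy_le_sum_mul_jumpFlux (M : SimplicialMesh Ω) (p : Finset (Euc d) → ℝ) :
    M.jumpEnergy p ≤ 2 * ∑ q ∈ M.sides, p q.1 * M.jumpFlux p q := by
  rw [Finset.mul_sum]
  refine sum_sides_le_sum_sides (fun q _ h => ?_) fun q hq q' hq' h hne => ?_
  · have hnonneg := jump_sq_div_faceWeight_nonneg (M := M) p q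
    rw [jumpFlux, ← mul_div_assoc]
    rw [jump_of_singleton p h, sq] at hnonneg ⊢
    linarith
  · rw [jumpFlux, jumpFlux, ← h, jump_of_pair p hq hq' h hne,
      jump_of_pair p hq' hq h.symm hne.symm]
    exact le_of_eq (by ring)

theorem norm_rtField_sq_le (hT : T ∈ M.cells) (α : Side d → ℝ) {x : Euc d}
    (hx : x ∈ convexHull ℝ (T : Set (Euc d))) :
    ‖rtField α T x‖ ^ 2 ≤ (d + 1) * (∑ z ∈ T, cellWeight T * α ⟨T, z⟩ ^ 2) /
      volume.real (convexHull ℝ (T : Set (Euc d))) := by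
  set V := volume.real (convexHull ℝ (T : Set (Euc d)))
  set D := Metric.diam (convexHull ℝ (T : Set (Euc d))) with hD
  have hsum : ‖rtField α T x‖ ≤ ∑ z ∈ T, |α ⟨T, z⟩| * (D / V) := by
    refine (norm_sum_le _ _).trans (Finset.sum_le_sum fun z hz => ?_)
    have hdist : ‖x - z‖ ≤ D := dist_eq_norm x z ▸ Metric.dist_le_diam_of_mem
      (isCompact_convexHull_finset T).isBounded hx (subset_convexHull ℝ _ hz)
    rw [norm_smul, Real.norm_eq_abs, abs_div, abs_of_nonneg measureReal_nonneg, div_mul_eq_mul_div,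
      ← mul_div_assoc]
    gcongr
  calc ‖rtField α T x‖ ^ 2
    _ ≤ (∑ z ∈ T, |α ⟨T, z⟩| * (D / V)) ^ 2 := by gcongr
    _ ≤ T.card * ∑ z ∈ T, (|α ⟨T, z⟩| * (D / V)) ^ 2 := sq_sum_le_card_mul_sum_sq
    _ = (d + 1) * (∑ z ∈ T, cellWeight T * α ⟨T, z⟩ ^ 2) / V := by
      rw [M.card_eq T hT, cellWeight, ← hD]
      simp only [mul_pow, sq_abs, ← Finset.sum_mul, ← Finset.mul_sum]
      push_cast
      ring

theorem setIntegral_norm_rtField_sq_le (hT : T ∈ M.cells) (α : Side d → ℝ) :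
    ∫ x in convexHull ℝ (T : Set (Euc d)), ‖rtField α T x‖ ^ 2 ≤
      (d + 1) * ∑ z ∈ T, cellWeight T * α ⟨T, z⟩ ^ 2 := by
  have hK := isCompact_convexHull_finset T
  calc ∫ x in convexHull ℝ (T : Set (Euc d)), ‖rtField α T x‖ ^ 2
    _ ≤ ∫ _ in convexHull ℝ (T : Set (Euc d)), (d + 1) * (∑ z ∈ T, cellWeight T * α ⟨T, z⟩ ^ 2) /
        volume.real (convexHull ℝ (T : Set (Euc d))) :=
      setIntegral_mono_on
        (((continuous_rtField α T).norm.pow 2).continuousOn.integrableOn_compact hK)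
        (continuousOn_const.integrableOn_compact hK) hK.measurableSet
        fun x hx => norm_rtField_sq_le hT α hx
    _ = (d + 1) * ∑ z ∈ T, cellWeight T * α ⟨T, z⟩ ^ 2 := by
      rw [setIntegral_const, smul_eq_mul, mul_div_cancel₀ _ (M.volume_real_pos hT).ne']

theorem sum_setIntegral_norm_rtField_jumpFlux_sq_le (hd : 1 ≤ d) (p : Finset (Euc d) → ℝ) :
    ∑ T ∈ M.cells, ∫ x in convexHull ℝ (T : Set (Euc d)), ‖rtField (M.jumpFlux p) T x‖ ^ 2 ≤
      (d + 1) * M.jumpEnergy p := by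
  refine (Finset.sum_le_sum fun T hT => setIntegral_norm_rtField_sq_le hT _).trans ?_
  rw [← Finset.mul_sum, ← M.sum_sides fun q => cellWeight q.1 * M.jumpFlux p q ^ 2]
  refine mul_le_mul_of_nonneg_left (Finset.sum_le_sum fun q hq => ?_) (by positivity)
  have hpos := faceWeight_pos hd hq
  calc cellWeight q.1 * M.jumpFlux p q ^ 2
    _ ≤ M.faceWeight q.face * M.jumpFlux p q ^ 2 := by
      gcongr
      exact cellWeight_le_faceWeight hq
    _ = M.jump p q ^ 2 / M.faceWeight q.face := by
      rw [jumpFlux]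
      field_simp

/-- The signed volume of the pyramid with apex `0` over the face that a side stands for. -/
def pyramidVolume (q : Side d) : ℝ :=
  volume.real (convexHull ℝ (q.1 : Set (Euc d))) * bary q.1 q.2 0

theorem sum_pyramidVolume (hT : T ∈ M.cells) :
    ∑ z ∈ T, pyramidVolume ⟨T, z⟩ = volume.real (convexHull ℝ (T : Set (Euc d))) := by
  simp only [pyramidVolume, ← Finset.mul_sum, (M.isSimplex hT).sum_bary, mul_one]

theorem pyramidVolume_eq_neg (hq : q ∈ M.sides) (hq' : q' ∈ M.sides) (h : q.face = q'.face)
    (hne : q ≠ q') : pyramidVolume q' = -pyramidVolume q := by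
  obtain ⟨hT, hz⟩ := mem_sides.1 hq
  obtain ⟨hT', hz'⟩ := mem_sides.1 hq'
  rw [pyramidVolume, pyramidVolume, (M.isSimplex hT).addHaar_real_eq_abs_bary_mul volume
      hz hz' h, (M.isSimplex hT).bary_eq_mul_bary (M.isSimplex hT') hz hz' h 0,
    abs_of_neg (bary_neg_of_face_eq hq hq' h hne)]
  ring

theorem abs_pyramidVolume_mul_diam_le (hd : 1 ≤ d) {σ ρ : ℝ} (hM : M.IsShapeRegular σ)
    (hρ : Ω ⊆ Metric.closedBall 0 ρ) (hq : q ∈ M.sides) :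
    |pyramidVolume q| * Metric.diam (convexHull ℝ (q.1 : Set (Euc d))) ≤
      σ * ρ * volume.real (convexHull ℝ (q.1 : Set (Euc d))) := by
  obtain ⟨hT, hz⟩ := mem_sides.1 hq
  obtain ⟨c, r, hr, hball, hdiam⟩ := hM q.1 hT
  have hσ : 0 ≤ σ := le_of_mul_le_mul_right
    ((zero_mul _).trans_le (Metric.diam_nonneg.trans hdiam)) (by positivity : 0 < 2 * r)
  obtain ⟨w, hw, hwz⟩ := Finset.exists_mem_ne (by rw [M.card_eq q.1 hT]; lia : 1 < q.1.card) q.2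
  have hwρ : ‖w‖ ≤ ρ := mem_closedBall_zero_iff.1 <|
    closure_minimal hρ Metric.isClosed_closedBall <|
      M.convexHull_subset_closure hT (subset_convexHull ℝ _ hw)
  have hbary : |bary q.1 q.2 0| * (2 * r) ≤ ρ := by
    have hzero : (bary q.1 q.2).linear (0 - w) = bary q.1 q.2 0 := by
      rw [← vsub_eq_sub, AffineMap.linearMap_vsub, (M.isSimplex hT).bary_of_ne hz hw hwz,
        vsub_eq_sub, sub_zero]
    rw [← hzero]
    refine ((M.isSimplex hT).abs_linear_bary_mul_le hz hr hball _).trans ?_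
    rwa [zero_sub, norm_neg]
  rw [pyramidVolume, abs_mul, abs_of_pos (M.volume_real_pos hT)]
  calc _ ≤ volume.real (convexHull ℝ (q.1 : Set (Euc d))) * |bary q.1 q.2 0| * (σ * (2 * r)) := by
        gcongr
    _ = σ * (|bary q.1 q.2 0| * (2 * r)) * volume.real (convexHull ℝ (q.1 : Set (Euc d))) := by ring
    _ ≤ _ := by gcongr

theorem pyramidVolume_sq_mul_cellWeight_le (hq : q ∈ M.sides) {K : ℝ}
    (h : |pyramidVolume q| * Metric.diam (convexHull ℝ (q.1 : Set (Euc d))) ≤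
      K * volume.real (convexHull ℝ (q.1 : Set (Euc d)))) :
    pyramidVolume q ^ 2 * cellWeight q.1 ≤
      K ^ 2 * volume.real (convexHull ℝ (q.1 : Set (Euc d))) := by
  have hV := M.volume_real_pos (mem_sides.1 hq).1
  rw [cellWeight, ← mul_div_assoc, div_le_iff₀ hV, ← sq_abs, ← mul_pow, mul_assoc, ← sq, ← mul_pow]
  gcongr

theorem abs_pyramidVolume_mul_cellWeight_le (hq : q ∈ M.sides) {K D : ℝ} (hK : 0 ≤ K)
    (h : |pyramidVolume q| * Metric.diam (convexHull ℝ (q.1 : Set (Euc d))) ≤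
      K * volume.real (convexHull ℝ (q.1 : Set (Euc d))))
    (hD : Metric.diam (convexHull ℝ (q.1 : Set (Euc d))) ≤ D) :
    |pyramidVolume q| * cellWeight q.1 ≤ K * D := by
  have hV := M.volume_real_pos (mem_sides.1 hq).1
  rw [cellWeight, ← mul_div_assoc, div_le_iff₀ hV, sq, ← mul_assoc]
  calc _ ≤ K * volume.real (convexHull ℝ (q.1 : Set (Euc d))) * D :=
        mul_le_mul h hD Metric.diam_nonneg (mul_nonneg hK hV.le)
    _ = _ := by ring

theorem pyramidVolume_mul_sq_sub_sq_le (hd : 1 ≤ d) (hq : q ∈ M.sides) {K D R' V' p p' : ℝ}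
    (hK : 0 < K) (hvol : |pyramidVolume q| * Metric.diam (convexHull ℝ (q.1 : Set (Euc d))) ≤
      K * volume.real (convexHull ℝ (q.1 : Set (Euc d))))
    (hdiam : Metric.diam (convexHull ℝ (q.1 : Set (Euc d))) ≤ D) (hR' : 0 ≤ R')
    (hV' : pyramidVolume q ^ 2 * R' ≤ K ^ 2 * V') (hW' : |pyramidVolume q| * R' ≤ K * D) :
    pyramidVolume q * (p ^ 2 - p' ^ 2) ≤
      (4 * (d + 1) * K ^ 2 + D ^ 2 / 2) * ((p - p') ^ 2 / (cellWeight q.1 + R')) +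
        (p ^ 2 * (volume.real (convexHull ℝ (q.1 : Set (Euc d))) / (d + 1)) +
          p' ^ 2 * (V' / (d + 1))) / 2 := by
  have hw := cellWeight_pos hd (mem_sides.1 hq).1
  have hscale : ∀ V : ℝ, K ^ 2 * V = (d + 1) * K ^ 2 * (V / (d + 1)) := fun V => by field_simp
  have hW : |pyramidVolume q| * (cellWeight q.1 + R') ≤ 2 * (K * D) := by
    linarith [abs_pyramidVolume_mul_cellWeight_le hq hK.le hvol hdiam]
  have hface := mul_sq_sub_sq_le (p := p) (p' := p') (L := 4 * D ^ 2)
    (by positivity : 0 < (d + 1) * K ^ 2) hw hR'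
    ((pyramidVolume_sq_mul_cellWeight_le hq hvol).trans_eq (hscale _)) (hV'.trans_eq (hscale _)) <|
    calc (pyramidVolume q * (cellWeight q.1 + R')) ^ 2
      _ = (|pyramidVolume q| * (cellWeight q.1 + R')) ^ 2 := by simp only [mul_pow, sq_abs]
      _ ≤ (2 * (K * D)) ^ 2 := by gcongr
      _ = K ^ 2 * (4 * D ^ 2) := by ring
      _ ≤ (d + 1) * K ^ 2 * (4 * D ^ 2) := by
        gcongr
        exact le_mul_of_one_le_left (sq_nonneg K) (by simp)
  exact hface.trans_eq (by ring)

theorem sum_pyramidVolume_mul_sq_le (hd : 1 ≤ d) {K D : ℝ} (hK : 0 < K)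
    (hvol : ∀ q ∈ M.sides, |pyramidVolume q| * Metric.diam (convexHull ℝ (q.1 : Set (Euc d))) ≤
      K * volume.real (convexHull ℝ (q.1 : Set (Euc d))))
    (hdiam : ∀ T ∈ M.cells, Metric.diam (convexHull ℝ (T : Set (Euc d))) ≤ D)
    (p : Finset (Euc d) → ℝ) :
    ∑ q ∈ M.sides, pyramidVolume q * p q.1 ^ 2 ≤
      ∑ q ∈ M.sides, ((4 * (d + 1) * K ^ 2 + D ^ 2 / 2) *
          (M.jump p q ^ 2 / M.faceWeight q.face) +
        p q.1 ^ 2 * (volume.real (convexHull ℝ (q.1 : Set (Euc d))) / (d + 1)) / 2) := by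
  have hdiam' : ∀ q ∈ M.sides, Metric.diam (convexHull ℝ (q.1 : Set (Euc d))) ≤ D :=
    fun q hq => hdiam _ (mem_sides.1 hq).1
  refine sum_sides_le_sum_sides (fun q hq h => ?_) fun q hq q' hq' h hne => ?_
  · have hKD := (abs_pyramidVolume_mul_cellWeight_le hq hK.le (hvol q hq) (hdiam' q hq)).trans'
      (mul_nonneg (abs_nonneg _) (cellWeight_pos hd (mem_sides.1 hq).1).le)
    have hface := pyramidVolume_mul_sq_sub_sq_le (p := p q.1) (p' := 0) (V' := 0) hd hq hK
      (hvol q hq) (hdiam' q hq) le_rfl (by simp) (by simpa using hKD)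
    rw [jump_of_singleton p h, faceWeight_of_singleton h]
    simpa using hface
  · have hneg := pyramidVolume_eq_neg hq hq' h hne
    have hV' := pyramidVolume_sq_mul_cellWeight_le hq' (hvol q' hq')
    have hW' := abs_pyramidVolume_mul_cellWeight_le hq' hK.le (hvol q' hq') (hdiam' q' hq')
    rw [hneg, neg_sq] at hV'
    rw [hneg, abs_neg] at hW'
    have hface := pyramidVolume_mul_sq_sub_sq_le (p := p q.1) (p' := p q'.1) hd hq hK
      (hvol q hq) (hdiam' q hq) (cellWeight_pos hd (mem_sides.1 hq').1).le hV' hW'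
    have hjump' := mul_nonneg (by positivity : 0 ≤ 4 * (d + 1) * K ^ 2 + D ^ 2 / 2)
      (jump_sq_div_faceWeight_nonneg (M := M) p q')
    rw [← faceWeight_of_pair hq hq' h hne, ← jump_of_pair p hq hq' h hne] at hface
    rw [hneg]
    linarith

/-- A discrete Poincaré inequality. As the signed volumes of the pyramids over a cell add up to the
volume of the cell and cancel at interior faces, the left-hand side is a sum over the faces of
differences of squares. -/
theorem sum_sq_mul_volume_le (hd : 1 ≤ d) {K D : ℝ} (hK : 0 < K)
    (hvol : ∀ q ∈ M.sides, |pyramidVolume q| * Metric.diam (convexHull ℝ (q.1 : Set (Euc d))) ≤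
      K * volume.real (convexHull ℝ (q.1 : Set (Euc d))))
    (hdiam : ∀ T ∈ M.cells, Metric.diam (convexHull ℝ (T : Set (Euc d))) ≤ D)
    (p : Finset (Euc d) → ℝ) :
    ∑ T ∈ M.cells, p T ^ 2 * volume.real (convexHull ℝ (T : Set (Euc d))) ≤
      (8 * (d + 1) * K ^ 2 + D ^ 2) * M.jumpEnergy p := by
  have hleft : ∑ q ∈ M.sides, pyramidVolume q * p q.1 ^ 2 =
      ∑ T ∈ M.cells, p T ^ 2 * volume.real (convexHull ℝ (T : Set (Euc d))) := by
    rw [M.sum_sides fun q => pyramidVolume q * p q.1 ^ 2]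
    refine Finset.sum_congr rfl fun T hT => ?_
    dsimp only
    rw [← Finset.sum_mul, sum_pyramidVolume hT, mul_comm]
  have hright : ∑ q ∈ M.sides,
      p q.1 ^ 2 * (volume.real (convexHull ℝ (q.1 : Set (Euc d))) / (d + 1)) / 2 =
      (∑ T ∈ M.cells, p T ^ 2 * volume.real (convexHull ℝ (T : Set (Euc d)))) / 2 := by
    rw [M.sum_sides fun q =>
      p q.1 ^ 2 * (volume.real (convexHull ℝ (q.1 : Set (Euc d))) / (d + 1)) / 2, Finset.sum_div]
    refine Finset.sum_congr rfl fun T hT => ?_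
    dsimp only
    rw [Finset.sum_const, M.card_eq T hT, nsmul_eq_mul]
    push_cast
    field_simp
  have hmain := sum_pyramidVolume_mul_sq_le hd hK hvol hdiam p
  rw [Finset.sum_add_distrib, ← Finset.mul_sum, hleft, hright, ← jumpEnergy] at hmain
  linarith

theorem norm_sq_eq_sum (M : SimplicialMesh Ω) (h0 : volume (frontier Ω) = 0) {w : L2Scal Ω}
    {p : Finset (Euc d) → ℝ} (hp : ∀ T ∈ M.cells,
      w =ᵐ[volume.restrict (convexHull ℝ (T : Set (Euc d)))] fun _ => p T) :
    ‖w‖ ^ 2 = ∑ T ∈ M.cells, p T ^ 2 * volume.real (convexHull ℝ (T : Set (Euc d))) := by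
  rw [norm_sq_eq_integral, M.setIntegral_eq_sum_of_ae_eq h0 (g := fun T _ => p T ^ 2)
    (fun _ _ => continuous_const) fun T hT => by
      filter_upwards [hp T hT] with x hx
      rw [hx, Real.norm_eq_abs, sq_abs]]
  exact Finset.sum_congr rfl fun T _ => by rw [setIntegral_const, smul_eq_mul, mul_comm]

theorem inner_div_eq_sum (h0 : volume (frontier Ω) = 0) {w : L2Scal Ω} {p : Finset (Euc d) → ℝ}
    (hp : ∀ T ∈ M.cells, w =ᵐ[volume.restrict (convexHull ℝ (T : Set (Euc d)))] fun _ => p T)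
    {α : Side d → ℝ} {v : Hdiv Ω} (hv : ∀ T ∈ M.cells,
      v.div =ᵐ[volume.restrict (convexHull ℝ (T : Set (Euc d)))] fun _ => rtDiv α T) :
    inner ℝ w v.div = d * ∑ q ∈ M.sides, p q.1 * α q := by
  rw [L2.inner_def, M.setIntegral_eq_sum_of_ae_eq h0 (g := fun T _ => p T * rtDiv α T)
    (fun _ _ => continuous_const) fun T hT => by
      filter_upwards [hp T hT, hv T hT] with x hx hx'
      rw [hx, hx', RCLike.inner_apply, conj_trivial, mul_comm],
    M.sum_sides fun q => p q.1 * α q, Finset.mul_sum]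
  refine Finset.sum_congr rfl fun T hT => ?_
  dsimp only
  rw [setIntegral_const, smul_eq_mul, rtDiv, ← Finset.mul_sum]
  have hV := M.volume_real_pos hT
  field_simp

theorem exists_mem_Vh_jumpEnergy_le (hd : 1 ≤ d) (hΩo : IsOpen Ω) (h0 : volume (frontier Ω) = 0)
    {w : L2Scal Ω} {p : Finset (Euc d) → ℝ} (hp : ∀ T ∈ M.cells,
      w =ᵐ[volume.restrict (convexHull ℝ (T : Set (Euc d)))] fun _ => p T) :
    ∃ v ∈ M.Vh, ‖v.toL2‖ ^ 2 ≤ (d + 1) * M.jumpEnergy p ∧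
      M.jumpEnergy p ≤ 2 * inner ℝ w v.div := by
  obtain ⟨v, hv, hrt⟩ := exists_mem_Vh_of_isConservative hΩo h0 (M.isConservative_jumpFlux p)
  refine ⟨v, hv, ?_, ?_⟩
  · rw [norm_sq_eq_integral, M.setIntegral_eq_sum_of_ae_eq h0
      (g := fun T x => ‖rtField (M.jumpFlux p) T x‖ ^ 2)
      (fun T _ => (continuous_rtField (M.jumpFlux p) T).norm.pow 2) fun T hT => by
        filter_upwards [(hrt T hT).1] with x hx
        rw [hx]]
    exact sum_setIntegral_norm_rtField_jumpFlux_sq_le hd p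
  · rw [inner_div_eq_sum h0 hp fun T hT => (hrt T hT).2]
    have hE := M.jumpEnergy_le_sum_mul_jumpFlux p
    have hd' : (1 : ℝ) ≤ d := by exact_mod_cast hd
    linarith [mul_le_mul_of_nonneg_right hd' ((M.jumpEnergy_nonneg p).trans hE)]

/-- The discrete inf-sup condition for `∇ ·`, in dual form: an element of `W_h` is controlled by
the norm of the functional which it induces on `V_h` through the divergence. -/
def IsInfSupStable (M : SimplicialMesh Ω) (C : ℝ) : Prop :=
  ∀ w ∈ M.Wh, ∀ N, 0 ≤ N → (∀ v ∈ M.Vh, inner ℝ w v.div ≤ N * ‖v.toL2‖) → ‖w‖ ≤ C * N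

theorem isInfSupStable_of_sum_sq_le (hd : 1 ≤ d) (hΩo : IsOpen Ω) (h0 : volume (frontier Ω) = 0)
    {A : ℝ} (hA : 0 ≤ A) (hpoincare : ∀ p : Finset (Euc d) → ℝ,
      ∑ T ∈ M.cells, p T ^ 2 * volume.real (convexHull ℝ (T : Set (Euc d))) ≤
        A * M.jumpEnergy p) :
    M.IsInfSupStable (2 * A + 2 * (d + 1)) := by
  intro w hw N hN h
  obtain ⟨p, hp⟩ := exists_ae_eq_const_of_mem_Wh h0 hw
  obtain ⟨v, hv, hvE, hE⟩ := exists_mem_Vh_jumpEnergy_le hd hΩo h0 hp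
  have hwE := hpoincare p
  rw [← M.norm_sq_eq_sum h0 hp] at hwE
  have hvN : ‖v.toL2‖ ≤ 2 * (d + 1) * N := by
    rcases (norm_nonneg v.toL2).eq_or_lt with hv0 | hv0
    · rw [← hv0]
      positivity
    · refine le_of_mul_le_mul_right ?_ hv0
      calc ‖v.toL2‖ * ‖v.toL2‖ = ‖v.toL2‖ ^ 2 := (sq _).symm
        _ ≤ (d + 1) * (2 * (N * ‖v.toL2‖)) :=
          hvE.trans (by gcongr; exact hE.trans (by gcongr; exact h v hv))
        _ = 2 * (d + 1) * N * ‖v.toL2‖ := by ring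
  refine abs_le_of_sq_le_sq' ?_ (by positivity) |>.2
  calc ‖w‖ ^ 2 ≤ A * (2 * (N * (2 * (d + 1) * N))) :=
        hwE.trans (by gcongr; exact hE.trans (by gcongr; exact (h v hv).trans (by gcongr)))
    _ = 2 * A * (2 * (d + 1)) * N ^ 2 := by ring
    _ ≤ ((2 * A + 2 * (d + 1)) * N) ^ 2 := by
      rw [mul_pow]
      gcongr
      nlinarith [sq_nonneg A]

theorem exists_isInfSupStable (hd : 1 ≤ d) (hΩo : IsOpen Ω) (hΩb : Bornology.IsBounded Ω)
    (h0 : volume (frontier Ω) = 0) (σ : ℝ) :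
    ∃ C : ℝ, 0 ≤ C ∧ ∀ M : SimplicialMesh Ω, M.IsShapeRegular σ → M.IsInfSupStable C := by
  obtain ⟨ρ, hρ⟩ := hΩb.subset_closedBall 0
  set K := max (σ * ρ) 1
  set A := 8 * (d + 1) * K ^ 2 + Metric.diam Ω ^ 2
  have hA : 0 ≤ A := by positivity
  refine ⟨2 * A + 2 * (d + 1), by positivity, fun M hM =>
    isInfSupStable_of_sum_sq_le hd hΩo h0 hA fun p => ?_⟩
  refine sum_sq_mul_volume_le hd (lt_max_of_lt_right one_pos) (fun q hq => ?_) (fun T hT => ?_) p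
  · refine (abs_pyramidVolume_mul_diam_le hd hM hρ hq).trans ?_
    gcongr
    exact le_max_left _ _
  · rw [← Metric.diam_closure Ω]
    exact Metric.diam_mono (M.convexHull_subset_closure hT) hΩb.closure

end SimplicialMesh

end InfSup

section NonlinearFlux

variable {X E F : Type*} [MeasurableSpace X] {μ : Measure X} [NormedAddCommGroup E]
  [NormedAddCommGroup F] {K : ℝ≥0} {f : E → F} {g : E → ℝ} {B m : ℝ}

theorem memLp_comp_of_lipschitzWith [IsFiniteMeasure μ] (hf : LipschitzWith K f) (S : Lp E 2 μ) :
    MemLp (fun x => f (S x)) 2 μ := by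
  have hsub : MemLp ((fun y => f y - f 0) ∘ S) 2 μ :=
    LipschitzWith.comp_memLp (hf.sub (LipschitzWith.const (f 0))) (sub_self _) (Lp.memLp S)
  exact (hsub.add (memLp_const (f 0))).ae_eq (ae_of_all _ fun x => sub_add_cancel _ _)

/-- The Nemytskii operator `S ↦ f ∘ S` of a Lipschitz function `f`, as a map between
`L²`-spaces. -/
def compL2 [IsFiniteMeasure μ] (hf : LipschitzWith K f) (S : Lp E 2 μ) : Lp F 2 μ :=
  (memLp_comp_of_lipschitzWith hf S).toLp

theorem coeFn_compL2 [IsFiniteMeasure μ] (hf : LipschitzWith K f) (S : Lp E 2 μ) :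
    compL2 hf S =ᵐ[μ] fun x => f (S x) :=
  (memLp_comp_of_lipschitzWith hf S).coeFn_toLp

theorem norm_compL2_sub_le [IsFiniteMeasure μ] (hf : LipschitzWith K f) (S S' : Lp E 2 μ) :
    ‖compL2 hf S - compL2 hf S'‖ ≤ K * ‖S - S'‖ := by
  refine Lp.norm_le_mul_norm_of_ae_le_mul ?_
  filter_upwards [coeFn_compL2 hf S, coeFn_compL2 hf S', Lp.coeFn_sub (compL2 hf S) (compL2 hf S'),
    Lp.coeFn_sub S S'] with x hS hS' hcomp hsub
  rw [hcomp, hsub, Pi.sub_apply, Pi.sub_apply, hS, hS']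
  exact hf.norm_sub_le _ _

theorem norm_compL2_sub_sq_le [IsFiniteMeasure μ] {s : ℝ → ℝ} (hs : LipschitzWith K s)
    (hmono : Monotone s) (Θ Θ' : Lp ℝ 2 μ) :
    ‖compL2 hs Θ - compL2 hs Θ'‖ ^ 2 ≤ K * inner ℝ (compL2 hs Θ - compL2 hs Θ') (Θ - Θ') := by
  rw [← real_inner_self_eq_norm_sq, L2.inner_def, L2.inner_def, ← integral_const_mul]
  refine integral_mono_ae (L2.integrable_inner _ _) ((L2.integrable_inner _ _).const_mul _) ?_
  filter_upwards [coeFn_compL2 hs Θ, coeFn_compL2 hs Θ', Lp.coeFn_sub (compL2 hs Θ) (compL2 hs Θ'),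
    Lp.coeFn_sub Θ Θ'] with x hΘ hΘ' hcomp hsub
  simp only [hcomp, hsub, Pi.sub_apply, hΘ, hΘ', RCLike.inner_apply, conj_trivial]
  have hlip := hs.norm_sub_le (Θ x) (Θ' x)
  have hnonneg : 0 ≤ (Θ x - Θ' x) * (s (Θ x) - s (Θ' x)) :=
    (monotone_id.monovary hmono).sub_mul_sub_nonneg _ _
  calc (s (Θ x) - s (Θ' x)) * (s (Θ x) - s (Θ' x))
    _ = ‖s (Θ x) - s (Θ' x)‖ * ‖s (Θ x) - s (Θ' x)‖ := by
      rw [Real.norm_eq_abs, abs_mul_abs_self]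
    _ ≤ K * ‖Θ x - Θ' x‖ * ‖s (Θ x) - s (Θ' x)‖ := by gcongr
    _ = K * |(Θ x - Θ' x) * (s (Θ x) - s (Θ' x))| := by
      rw [abs_mul, mul_assoc, Real.norm_eq_abs, Real.norm_eq_abs]
    _ = K * ((Θ x - Θ' x) * (s (Θ x) - s (Θ' x))) := by rw [abs_of_nonneg hnonneg]

variable [InnerProductSpace ℝ F]

theorem memLp_smul_of_lipschitzWith (hg : LipschitzWith K g) (hB : ∀ y, |g y| ≤ B) (S : Lp E 2 μ)
    (u : Lp F 2 μ) : MemLp (fun x => g (S x) • u x) 2 μ := by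
  refine MemLp.of_le_mul (c := B) (Lp.memLp u)
    ((hg.continuous.comp_aestronglyMeasurable (Lp.aestronglyMeasurable S)).smul
      (Lp.aestronglyMeasurable u)) (ae_of_all _ fun x => ?_)
  rw [norm_smul]
  gcongr
  exact hB _

/-- The field `g(S) u`, as an element of `L²`. -/
def smulL2 (hg : LipschitzWith K g) (hB : ∀ y, |g y| ≤ B) (S : Lp E 2 μ) (u : Lp F 2 μ) :
    Lp F 2 μ :=
  (memLp_smul_of_lipschitzWith hg hB S u).toLp

theorem coeFn_smulL2 (hg : LipschitzWith K g) (hB : ∀ y, |g y| ≤ B) (S : Lp E 2 μ)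
    (u : Lp F 2 μ) : smulL2 hg hB S u =ᵐ[μ] fun x => g (S x) • u x :=
  (memLp_smul_of_lipschitzWith hg hB S u).coeFn_toLp

theorem smulL2_sub (hg : LipschitzWith K g) (hB : ∀ y, |g y| ≤ B) (S : Lp E 2 μ)
    (u u' : Lp F 2 μ) : smulL2 hg hB S (u - u') = smulL2 hg hB S u - smulL2 hg hB S u' := by
  refine Lp.ext ?_
  filter_upwards [coeFn_smulL2 hg hB S u, coeFn_smulL2 hg hB S u', coeFn_smulL2 hg hB S (u - u'),
    Lp.coeFn_sub (smulL2 hg hB S u) (smulL2 hg hB S u'), Lp.coeFn_sub u u']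
    with x hu hu' huu' hsmul hsub
  rw [huu', hsmul, hsub, Pi.sub_apply, Pi.sub_apply, hu, hu', smul_sub]

theorem norm_smulL2_le (hg : LipschitzWith K g) (hB : ∀ y, |g y| ≤ B) (S : Lp E 2 μ)
    (u : Lp F 2 μ) : ‖smulL2 hg hB S u‖ ≤ B * ‖u‖ := by
  refine Lp.norm_le_mul_norm_of_ae_le_mul ?_
  filter_upwards [coeFn_smulL2 hg hB S u] with x hx
  rw [hx, norm_smul]
  gcongr
  exact hB _

theorem mul_norm_sq_le_inner_smulL2 (hg : LipschitzWith K g) (hB : ∀ y, |g y| ≤ B) {α : ℝ}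
    (hα : ∀ y, α ≤ g y) (S : Lp E 2 μ) (u : Lp F 2 μ) :
    α * ‖u‖ ^ 2 ≤ inner ℝ (smulL2 hg hB S u) u := by
  rw [← real_inner_self_eq_norm_sq, L2.inner_def, L2.inner_def, ← integral_const_mul]
  refine integral_mono_ae ((L2.integrable_inner _ _).const_mul _) (L2.integrable_inner _ _) ?_
  filter_upwards [coeFn_smulL2 hg hB S u] with x hx
  rw [hx, real_inner_smul_left]
  exact mul_le_mul_of_nonneg_right (hα _) real_inner_self_nonneg

theorem norm_smulL2_sub_smulL2_le (hg : LipschitzWith K g) (hB : ∀ y, |g y| ≤ B)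
    (S S' : Lp E 2 μ) {u : Lp F 2 μ} (hu : ∀ᵐ x ∂μ, ‖u x‖ ≤ m) :
    ‖smulL2 hg hB S u - smulL2 hg hB S' u‖ ≤ K * m * ‖S - S'‖ := by
  refine Lp.norm_le_mul_norm_of_ae_le_mul ?_
  filter_upwards [coeFn_smulL2 hg hB S u, coeFn_smulL2 hg hB S' u,
    Lp.coeFn_sub (smulL2 hg hB S u) (smulL2 hg hB S' u), Lp.coeFn_sub S S', hu]
    with x hS hS' hsmul hsub hux
  rw [hsmul, hsub, Pi.sub_apply, Pi.sub_apply, hS, hS', ← sub_smul, norm_smul]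
  calc ‖g (S x) - g (S' x)‖ * ‖u x‖ ≤ (K * ‖S x - S' x‖) * m := by
        gcongr
        exact hg.norm_sub_le _ _
    _ = K * m * ‖S x - S' x‖ := by ring

/-- The flux `g(S) u + f(S)`, as an element of `L²`. -/
def nonlinearFlux [IsFiniteMeasure μ] (hg : LipschitzWith K g) (hB : ∀ y, |g y| ≤ B)
    (hf : LipschitzWith K f) (S : Lp E 2 μ) (u : Lp F 2 μ) : Lp F 2 μ :=
  smulL2 hg hB S u + compL2 hf S

theorem norm_nonlinearFlux_sub_sub_smulL2_le [IsFiniteMeasure μ] (hg : LipschitzWith K g)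
    (hB : ∀ y, |g y| ≤ B) (hf : LipschitzWith K f) (S S' : Lp E 2 μ) {u u' : Lp F 2 μ}
    (hu' : ∀ᵐ x ∂μ, ‖u' x‖ ≤ m) :
    ‖nonlinearFlux hg hB hf S u - nonlinearFlux hg hB hf S' u' - smulL2 hg hB S (u - u')‖ ≤
      K * (m + 1) * ‖S - S'‖ := by
  have hsplit : nonlinearFlux hg hB hf S u - nonlinearFlux hg hB hf S' u' -
      smulL2 hg hB S (u - u') =
      (smulL2 hg hB S u' - smulL2 hg hB S' u') + (compL2 hf S - compL2 hf S') := by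
    rw [nonlinearFlux, nonlinearFlux, smulL2_sub]
    abel
  rw [hsplit]
  linarith [norm_add_le (smulL2 hg hB S u' - smulL2 hg hB S' u') (compL2 hf S - compL2 hf S'),
    norm_smulL2_sub_smulL2_le hg hB S S' hu', norm_compL2_sub_le hf S S']

theorem norm_nonlinearFlux_sub_le [IsFiniteMeasure μ] (hg : LipschitzWith K g)
    (hB : ∀ y, |g y| ≤ B) (hf : LipschitzWith K f) (S S' : Lp E 2 μ) {u u' : Lp F 2 μ}
    (hu' : ∀ᵐ x ∂μ, ‖u' x‖ ≤ m) :
    ‖nonlinearFlux hg hB hf S u - nonlinearFlux hg hB hf S' u'‖ ≤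
      B * ‖u - u'‖ + K * (m + 1) * ‖S - S'‖ :=
  (norm_le_norm_add_norm_sub' _ (smulL2 hg hB S (u - u'))).trans <|
    add_le_add (norm_smulL2_le hg hB S _) (norm_nonlinearFlux_sub_sub_smulL2_le hg hB hf S S' hu')

theorem mul_norm_sq_le_inner_nonlinearFlux_sub [IsFiniteMeasure μ] (hg : LipschitzWith K g)
    (hB : ∀ y, |g y| ≤ B) (hf : LipschitzWith K f) {α : ℝ} (hα : ∀ y, α ≤ g y) (S S' : Lp E 2 μ)
    {u u' : Lp F 2 μ} (hu' : ∀ᵐ x ∂μ, ‖u' x‖ ≤ m) :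
    α * ‖u - u'‖ ^ 2 ≤
      inner ℝ (nonlinearFlux hg hB hf S u - nonlinearFlux hg hB hf S' u') (u - u') +
        K * (m + 1) * ‖S - S'‖ * ‖u - u'‖ := by
  have hrest := neg_le_of_abs_le <| (abs_real_inner_le_norm (nonlinearFlux hg hB hf S u -
    nonlinearFlux hg hB hf S' u' - smulL2 hg hB S (u - u')) (u - u')).trans <|
    mul_le_mul_of_nonneg_right (norm_nonlinearFlux_sub_sub_smulL2_le hg hB hf S S' hu')
      (norm_nonneg _)
  rw [inner_sub_left] at hrest
  linarith [mul_norm_sq_le_inner_smulL2 hg hB hα S (u - u')]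

end NonlinearFlux

section Integral

variable {X : Type*} [MeasurableSpace X] {μ : Measure X}

theorem integral_inner_eq_inner {F : Type*} [NormedAddCommGroup F] [InnerProductSpace ℝ F]
    {f : X → F} {v : Lp F 2 μ} (hv : v =ᵐ[μ] f) (w : Lp F 2 μ) :
    ∫ x, inner ℝ (f x) (w x) ∂μ = inner ℝ v w := by
  rw [L2.inner_def]
  refine integral_congr_ae ?_
  filter_upwards [hv] with x hx
  rw [hx]

theorem integral_mul_eq_inner {f : X → ℝ} {v : Lp ℝ 2 μ} (hv : v =ᵐ[μ] f) (w : Lp ℝ 2 μ) :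
    ∫ x, f x * w x ∂μ = inner ℝ v w := by
  simp only [← integral_inner_eq_inner hv w, RCLike.inner_apply, conj_trivial, mul_comm]

end Integral

namespace Hdiv

variable {d : ℕ} {Ω : Set (Euc d)}

theorem hasWeakDiv_sub (v w : Hdiv Ω) : HasWeakDiv Ω (v.toL2 - w.toL2) (v.div - w.div) := by
  intro φ hφ hφc hφΩ
  have hφ1 : ContDiff ℝ 1 φ := hφ.of_le (by exact_mod_cast le_top)
  have hgrad : MemLp (gradient φ) 2 (volume.restrict Ω) :=
    ((((LinearIsometryEquiv.continuous _).comp (hφ1.continuous_fderiv one_ne_zero)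
      ).memLp_of_hasCompactSupport <| (hφc.fderiv ℝ).comp_left <|
        map_zero (InnerProductSpace.toDual ℝ (Euc d)).symm)).restrict Ω
  have hφ2 : MemLp φ 2 (volume.restrict Ω) :=
    (hφ.continuous.memLp_of_hasCompactSupport hφc).restrict Ω
  have hinner : ∀ v : L2Vec Ω, ∫ x in Ω, inner ℝ (v x) (gradient φ x) = inner ℝ hgrad.toLp v := by
    intro v
    rw [← integral_inner_eq_inner hgrad.coeFn_toLp]
    simp only [real_inner_comm]
  have hmul : ∀ g : L2Scal Ω, ∫ x in Ω, g x * φ x = inner ℝ hφ2.toLp g := by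
    intro g
    rw [← integral_mul_eq_inner hφ2.coeFn_toLp]
    simp only [mul_comm]
  have hv := v.hasWeakDiv_div φ hφ hφc hφΩ
  have hw := w.hasWeakDiv_div φ hφ hφc hφΩ
  rw [hinner, hmul] at hv hw ⊢
  rw [inner_sub_right, inner_sub_right, hv, hw]
  ring

/-- The difference of two fields in `H(div; Ω)`. -/
def sub (v w : Hdiv Ω) : Hdiv Ω := ⟨v.toL2 - w.toL2, _, hasWeakDiv_sub v w⟩

theorem toL2_sub (v w : Hdiv Ω) : (v.sub w).toL2 = v.toL2 - w.toL2 := rfl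

theorem div_sub (hΩo : IsOpen Ω) (v w : Hdiv Ω) : (v.sub w).div = v.div - w.div :=
  div_eq_of_hasWeakDiv hΩo _ _ (hasWeakDiv_sub v w)

end Hdiv

namespace SimplicialMesh

variable {d : ℕ} {Ω : Set (Euc d)} {M : SimplicialMesh Ω}

theorem sub_mem_Wh {v w : L2Scal Ω} (hv : v ∈ M.Wh) (hw : w ∈ M.Wh) : v - w ∈ M.Wh := by
  intro T hT
  obtain ⟨a, ha⟩ := hv T hT
  obtain ⟨b, hb⟩ := hw T hT
  refine ⟨a - b, ?_⟩
  filter_upwards [ha, hb, Lp.coeFn_sub v w] with x hvx hwx hsub hx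
  rw [hsub, Pi.sub_apply, hvx hx, hwx hx]

theorem sub_mem_Vh {v w : Hdiv Ω} (hv : v ∈ M.Vh) (hw : w ∈ M.Vh) : v.sub w ∈ M.Vh := by
  intro T hT
  obtain ⟨a, b, ha⟩ := hv T hT
  obtain ⟨a', b', ha'⟩ := hw T hT
  refine ⟨a - a', b - b', ?_⟩
  filter_upwards [ha, ha', Lp.coeFn_sub v.toL2 w.toL2] with x hvx hwx hsub hx
  rw [Hdiv.toL2_sub, hsub, Pi.sub_apply, hvx hx, hwx hx, sub_smul]
  abel

end SimplicialMesh

section Uniqueness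

variable {d : ℕ} {Ω : Set (Euc d)} {c : FlowCoeffs d} {K : ℝ≥0} {B α : ℝ}

/-- Monotonicity, Lipschitz continuity and boundedness of the coefficient functions, with explicit
constants. -/
structure FlowCoeffs.IsRegular (c : FlowCoeffs d) (K : ℝ≥0) (B α : ℝ) : Prop where
  s_mono : Monotone c.s
  s_lip : LipschitzWith K c.s
  a_lip : LipschitzWith K c.a
  fw_lip : LipschitzWith K c.fw
  f1_lip : LipschitzWith K c.f1
  f2_lip : LipschitzWith K c.f2
  f3_lip : LipschitzWith K c.f3
  le_a : ∀ y, α ≤ c.a y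
  abs_a_le : ∀ y, |c.a y| ≤ B
  abs_fw_le : ∀ y, |c.fw y| ≤ B

theorem FlowCoeffs.Admissible.exists_isRegular (hc : c.Admissible) :
    ∃ (K : ℝ≥0) (B α : ℝ), 0 < α ∧ c.IsRegular K B α := by
  obtain ⟨Ks, hs⟩ := hc.s_lip
  obtain ⟨Ka, ha⟩ := hc.a_lip
  obtain ⟨Kw, hw⟩ := hc.fw_lip
  obtain ⟨K1, h1⟩ := hc.f1_lip
  obtain ⟨K2, h2⟩ := hc.f2_lip
  obtain ⟨K3, h3⟩ := hc.f3_lip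
  obtain ⟨α, A, hα, hαA⟩ := hc.a_bounds
  obtain ⟨B, hB⟩ := hc.fw_bdd
  refine ⟨Ks ⊔ Ka ⊔ Kw ⊔ K1 ⊔ K2 ⊔ K3, max A B, α, hα, hc.s_mono, hs.weaken (by simp),
    ha.weaken (by simp), hw.weaken (by simp), h1.weaken (by simp), h2.weaken (by simp),
    h3.weaken (by simp), fun y => (hαA y).1, fun y => ?_, fun y => (hB y).trans (le_max_right _ _)⟩
  rw [abs_of_nonneg (hα.le.trans (hαA y).1)]
  exact (hαA y).2.trans (le_max_left _ _)

namespace FlowCoeffs.IsRegular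

variable [IsFiniteMeasure (volume.restrict Ω)]

/-- The saturation `s(Θ)`. -/
def saturation (hc : c.IsRegular K B α) (Θ : L2Scal Ω) : L2Scal Ω := compL2 hc.s_lip Θ

/-- The right-hand side `f_w(s(Θ)) u + f_1(s(Θ))` of the flux equation. -/
def convectiveFlux (hc : c.IsRegular K B α) (X : FlowState Ω) : L2Vec Ω :=
  nonlinearFlux hc.fw_lip hc.abs_fw_le hc.f1_lip (hc.saturation X.Θ) X.u.toL2

/-- The left-hand side `a(s(Θ)) u + f_3(s(Θ))` of Darcy's law for the total flux. -/
def darcyForce (hc : c.IsRegular K B α) (X : FlowState Ω) : L2Vec Ω :=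
  nonlinearFlux hc.a_lip hc.abs_a_le hc.f3_lip (hc.saturation X.Θ) X.u.toL2

theorem coeFn_saturation (hc : c.IsRegular K B α) (Θ : L2Scal Ω) :
    hc.saturation Θ =ᵐ[volume.restrict Ω] fun x => c.s (Θ x) :=
  coeFn_compL2 hc.s_lip Θ

theorem coeFn_compL2_saturation (hc : c.IsRegular K B α) {F : Type*} [NormedAddCommGroup F]
    {f : ℝ → F} (hf : LipschitzWith K f) (Θ : L2Scal Ω) :
    compL2 hf (hc.saturation Θ) =ᵐ[volume.restrict Ω] fun x => f (c.s (Θ x)) :=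
  (coeFn_compL2 hf _).trans ((hc.coeFn_saturation Θ).fun_comp f)

theorem coeFn_smulL2_saturation (hc : c.IsRegular K B α) {g : ℝ → ℝ} (hg : LipschitzWith K g)
    (hB : ∀ y, |g y| ≤ B) (Θ : L2Scal Ω) (u : L2Vec Ω) :
    smulL2 hg hB (hc.saturation Θ) u =ᵐ[volume.restrict Ω] fun x => g (c.s (Θ x)) • u x := by
  filter_upwards [coeFn_smulL2 hg hB (hc.saturation Θ) u, hc.coeFn_saturation Θ] with x hx hΘ
  rw [hx, hΘ]

end FlowCoeffs.IsRegular

theorem le_max_one_div_mul_of_mul_sq_le {u s A b : ℝ} (hα : 0 < α) (hs : 0 ≤ s) (hb : 0 ≤ b)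
    (h : α * u ^ 2 ≤ A * (s * u) + b * s ^ 2) : u ≤ max 1 ((A + b) / α) * s := by
  rcases le_or_gt u s with hus | hsu
  · exact hus.trans (le_mul_of_one_le_left hs (le_max_left _ _))
  · have hss : b * s ^ 2 ≤ b * (s * u) := by
      rw [sq]
      gcongr
    have hlin : α * u ≤ (A + b) * s :=
      le_of_mul_le_mul_right (by linarith) (hs.trans_lt hsu)
    refine ((le_div_iff₀' hα).2 hlin).trans ?_
    rw [mul_div_right_comm]
    gcongr
    exact le_max_right _ _

theorem eq_zero_of_add_mul_sq_le {κ N τ s q x : ℝ} (hκ : 0 ≤ κ) (hτ : 0 < τ)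
    (hsmall : κ * N ^ 2 * τ < 4) (hsx : s ^ 2 ≤ κ * x)
    (h : x + τ * q ^ 2 ≤ τ * (N * s * q)) : s = 0 := by
  have hx : x ≤ τ * (N ^ 2 * s ^ 2 / 4) := by
    have hyoung : τ * (N * s * q) ≤ τ * (q ^ 2 + N ^ 2 * s ^ 2 / 4) := by
      gcongr
      linarith [sq_nonneg (q - N * s / 2)]
    linarith
  have hs : (4 - κ * N ^ 2 * τ) * s ^ 2 ≤ 0 := by
    linarith [mul_le_mul_of_nonneg_left hx hκ]
  exact pow_eq_zero_iff two_ne_zero |>.1 <|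
    (nonpos_of_mul_nonpos_right hs (by linarith)).antisymm (sq_nonneg s)

theorem FlowState.ext_of_sub_eq_zero {X Y : FlowState Ω} (hΘ : X.Θ - Y.Θ = 0)
    (hq : X.q.toL2 - Y.q.toL2 = 0) (hp : X.p - Y.p = 0) (hu : X.u.toL2 - Y.u.toL2 = 0) :
    X = Y := by
  cases X
  cases Y
  simp only [FlowState.mk.injEq]
  exact ⟨sub_eq_zero.1 hΘ, Subtype.ext (sub_eq_zero.1 hq), sub_eq_zero.1 hp,
    Subtype.ext (sub_eq_zero.1 hu)⟩

namespace IsDiscreteSolution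

variable [IsFiniteMeasure (volume.restrict Ω)] {M : SimplicialMesh Ω} {τ : ℝ} {Θprev : L2Scal Ω}
  {X Y : FlowState Ω}

theorem inner_saturation (hc : c.IsRegular K B α) (hX : IsDiscreteSolution c M τ Θprev X)
    {w : L2Scal Ω} (hw : w ∈ M.Wh) :
    inner ℝ (hc.saturation X.Θ - hc.saturation Θprev) w + τ * inner ℝ X.q.div w = 0 := by
  have hs : ⇑(hc.saturation X.Θ - hc.saturation Θprev) =ᵐ[volume.restrict Ω]
      fun x => c.s (X.Θ x) - c.s (Θprev x) :=
    (Lp.coeFn_sub _ _).trans ((hc.coeFn_saturation X.Θ).sub (hc.coeFn_saturation Θprev))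
  rw [← integral_mul_eq_inner hs, ← integral_mul_eq_inner .rfl, hX.saturation_eq w hw]

theorem inner_flux (hc : c.IsRegular K B α) (hX : IsDiscreteSolution c M τ Θprev X) {v : Hdiv Ω}
    (hv : v ∈ M.Vh) :
    inner ℝ X.q.toL2 v.toL2 - inner ℝ X.Θ v.div = inner ℝ (hc.convectiveFlux X) v.toL2 := by
  have h := hX.flux_eq v hv
  rw [integral_inner_eq_inner .rfl, integral_mul_eq_inner .rfl,
    integral_inner_eq_inner (hc.coeFn_smulL2_saturation hc.fw_lip hc.abs_fw_le X.Θ X.u.toL2),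
    integral_inner_eq_inner (hc.coeFn_compL2_saturation hc.f1_lip X.Θ)] at h
  rw [FlowCoeffs.IsRegular.convectiveFlux, nonlinearFlux, inner_add_left, ← h, add_sub_cancel]

theorem inner_total_flux (hc : c.IsRegular K B α) (hX : IsDiscreteSolution c M τ Θprev X)
    {w : L2Scal Ω} (hw : w ∈ M.Wh) :
    inner ℝ X.u.div w = inner ℝ (compL2 hc.f2_lip (hc.saturation X.Θ)) w := by
  rw [← integral_mul_eq_inner .rfl,
    ← integral_mul_eq_inner (hc.coeFn_compL2_saturation hc.f2_lip X.Θ), hX.total_flux_eq w hw]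

theorem inner_pressure (hc : c.IsRegular K B α) (hX : IsDiscreteSolution c M τ Θprev X)
    {v : Hdiv Ω} (hv : v ∈ M.Vh) :
    inner ℝ X.p v.div = inner ℝ (hc.darcyForce X) v.toL2 := by
  have h := hX.pressure_eq v hv
  rw [integral_mul_eq_inner .rfl,
    integral_inner_eq_inner (hc.coeFn_smulL2_saturation hc.a_lip hc.abs_a_le X.Θ X.u.toL2),
    integral_inner_eq_inner (hc.coeFn_compL2_saturation hc.f3_lip X.Θ)] at h
  rw [FlowCoeffs.IsRegular.darcyForce, nonlinearFlux, inner_add_left]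
  linarith

theorem norm_pressure_sub_le (hc : c.IsRegular K B α) {C m : ℝ} (hM : M.IsInfSupStable C)
    (hm : 0 ≤ m) (hX : IsDiscreteSolution c M τ Θprev X) (hY : IsDiscreteSolution c M τ Θprev Y)
    (hYm : ∀ᵐ x ∂volume.restrict Ω, ‖Y.u.toL2 x‖ ≤ m) :
    ‖X.p - Y.p‖ ≤ C * (B * ‖X.u.toL2 - Y.u.toL2‖ +
      K * (m + 1) * ‖hc.saturation X.Θ - hc.saturation Y.Θ‖) := by
  have hB : 0 ≤ B := (abs_nonneg _).trans (hc.abs_a_le 0)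
  refine hM _ (SimplicialMesh.sub_mem_Wh hX.p_mem hY.p_mem) _ (by positivity) fun v hv => ?_
  rw [inner_sub_left, hX.inner_pressure hc hv, hY.inner_pressure hc hv, ← inner_sub_left]
  refine (real_inner_le_norm _ _).trans ?_
  gcongr
  exact norm_nonlinearFlux_sub_le _ _ _ _ _ hYm

theorem mul_norm_total_flux_sub_sq_le (hc : c.IsRegular K B α) (hΩo : IsOpen Ω) {m : ℝ}
    (hX : IsDiscreteSolution c M τ Θprev X) (hY : IsDiscreteSolution c M τ Θprev Y)
    (hYm : ∀ᵐ x ∂volume.restrict Ω, ‖Y.u.toL2 x‖ ≤ m) :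
    α * ‖X.u.toL2 - Y.u.toL2‖ ^ 2 ≤
      K * ‖hc.saturation X.Θ - hc.saturation Y.Θ‖ * ‖X.p - Y.p‖ +
        K * (m + 1) * ‖hc.saturation X.Θ - hc.saturation Y.Θ‖ * ‖X.u.toL2 - Y.u.toL2‖ := by
  have hp := SimplicialMesh.sub_mem_Wh hX.p_mem hY.p_mem
  have hu := SimplicialMesh.sub_mem_Vh hX.u_mem hY.u_mem
  refine (mul_norm_sq_le_inner_nonlinearFlux_sub hc.a_lip hc.abs_a_le hc.f3_lip hc.le_a _ _
    hYm).trans (add_le_add_left ?_ _)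
  calc inner ℝ (hc.darcyForce X - hc.darcyForce Y) (X.u.toL2 - Y.u.toL2)
    _ = inner ℝ (X.p - Y.p) (X.u.sub Y.u).div := by
      rw [← Hdiv.toL2_sub, inner_sub_left, inner_sub_left, hX.inner_pressure hc hu,
        hY.inner_pressure hc hu]
    _ = inner ℝ (compL2 hc.f2_lip (hc.saturation X.Θ) - compL2 hc.f2_lip (hc.saturation Y.Θ))
        (X.p - Y.p) := by
      rw [Hdiv.div_sub hΩo, real_inner_comm, inner_sub_left, inner_sub_left,
        hX.inner_total_flux hc hp, hY.inner_total_flux hc hp]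
    _ ≤ K * ‖hc.saturation X.Θ - hc.saturation Y.Θ‖ * ‖X.p - Y.p‖ := by
      refine (real_inner_le_norm _ _).trans ?_
      gcongr
      exact norm_compL2_sub_le hc.f2_lip _ _

theorem inner_saturation_sub_add_norm_flux_sub_sq (hc : c.IsRegular K B α) (hΩo : IsOpen Ω)
    (hX : IsDiscreteSolution c M τ Θprev X) (hY : IsDiscreteSolution c M τ Θprev Y) :
    inner ℝ (hc.saturation X.Θ - hc.saturation Y.Θ) (X.Θ - Y.Θ) +
      τ * ‖X.q.toL2 - Y.q.toL2‖ ^ 2 =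
        τ * inner ℝ (hc.convectiveFlux X - hc.convectiveFlux Y) (X.q.toL2 - Y.q.toL2) := by
  have hΘ := SimplicialMesh.sub_mem_Wh hX.Θ_mem hY.Θ_mem
  have hq := SimplicialMesh.sub_mem_Vh hX.q_mem hY.q_mem
  have hsat : inner ℝ (hc.saturation X.Θ - hc.saturation Y.Θ) (X.Θ - Y.Θ) +
      τ * inner ℝ (X.Θ - Y.Θ) (X.q.sub Y.q).div = 0 := by
    have hXsat := hX.inner_saturation hc hΘ
    have hYsat := hY.inner_saturation hc hΘ
    rw [inner_sub_left] at hXsat hYsat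
    rw [Hdiv.div_sub hΩo, real_inner_comm _ (X.Θ - Y.Θ), inner_sub_left, inner_sub_left]
    linarith
  have hflux : ‖X.q.toL2 - Y.q.toL2‖ ^ 2 - inner ℝ (X.Θ - Y.Θ) (X.q.sub Y.q).div =
      inner ℝ (hc.convectiveFlux X - hc.convectiveFlux Y) (X.q.toL2 - Y.q.toL2) := by
    rw [← real_inner_self_eq_norm_sq, ← Hdiv.toL2_sub, inner_sub_left (hc.convectiveFlux X),
      ← hX.inner_flux hc hq, ← hY.inner_flux hc hq, Hdiv.toL2_sub, inner_sub_left X.q.toL2,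
      inner_sub_left X.Θ]
    ring
  rw [← hflux, mul_sub]
  linarith

theorem norm_total_flux_sub_le (hc : c.IsRegular K B α) (hΩo : IsOpen Ω) (hα : 0 < α) {C m : ℝ}
    (hC : 0 ≤ C) (hM : M.IsInfSupStable C) (hm : 0 ≤ m) (hX : IsDiscreteSolution c M τ Θprev X)
    (hY : IsDiscreteSolution c M τ Θprev Y) (hYm : ∀ᵐ x ∂volume.restrict Ω, ‖Y.u.toL2 x‖ ≤ m) :
    ‖X.u.toL2 - Y.u.toL2‖ ≤
      max 1 ((K * C * B + K * (m + 1) + K * C * (K * (m + 1))) / α) *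
        ‖hc.saturation X.Θ - hc.saturation Y.Θ‖ := by
  refine le_max_one_div_mul_of_mul_sq_le hα (norm_nonneg _) (by positivity) ?_
  have hp := mul_le_mul_of_nonneg_left (hX.norm_pressure_sub_le hc hM hm hY hYm)
    (mul_nonneg K.2 (norm_nonneg (hc.saturation X.Θ - hc.saturation Y.Θ)))
  refine (hX.mul_norm_total_flux_sub_sq_le hc hΩo hY hYm).trans
    ((add_le_add_left hp _).trans_eq ?_)
  simp only [NNReal.val_eq_coe]
  ring

theorem norm_convectiveFlux_sub_le (hc : c.IsRegular K B α) {E m : ℝ}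
    (hYm : ∀ᵐ x ∂volume.restrict Ω, ‖Y.u.toL2 x‖ ≤ m)
    (hu : ‖X.u.toL2 - Y.u.toL2‖ ≤ E * ‖hc.saturation X.Θ - hc.saturation Y.Θ‖) :
    ‖hc.convectiveFlux X - hc.convectiveFlux Y‖ ≤
      (B * E + K * (m + 1)) * ‖hc.saturation X.Θ - hc.saturation Y.Θ‖ := by
  have hB : 0 ≤ B := (abs_nonneg _).trans (hc.abs_fw_le 0)
  refine (norm_nonlinearFlux_sub_le hc.fw_lip hc.abs_fw_le hc.f1_lip _ _ hYm).trans ?_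
  rw [add_mul, mul_assoc B]
  gcongr

theorem saturation_eq_of_norm_total_flux_sub_le (hc : c.IsRegular K B α) (hΩo : IsOpen Ω)
    {E m : ℝ} (hτ : 0 < τ) (hsmall : K * (B * E + K * (m + 1)) ^ 2 * τ < 4)
    (hX : IsDiscreteSolution c M τ Θprev X) (hY : IsDiscreteSolution c M τ Θprev Y)
    (hYm : ∀ᵐ x ∂volume.restrict Ω, ‖Y.u.toL2 x‖ ≤ m)
    (hu : ‖X.u.toL2 - Y.u.toL2‖ ≤ E * ‖hc.saturation X.Θ - hc.saturation Y.Θ‖) :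
    hc.saturation X.Θ = hc.saturation Y.Θ := by
  have henergy := hX.inner_saturation_sub_add_norm_flux_sub_sq hc hΩo hY
  refine sub_eq_zero.1 (norm_eq_zero.1 (eq_zero_of_add_mul_sq_le K.2 hτ hsmall
    (norm_compL2_sub_sq_le hc.s_lip hc.s_mono X.Θ Y.Θ) (henergy.trans_le ?_)))
  gcongr
  refine (real_inner_le_norm _ _).trans ?_
  gcongr
  exact norm_convectiveFlux_sub_le hc hYm hu

theorem eq_of_saturation_eq (hc : c.IsRegular K B α) (hΩo : IsOpen Ω) {C E m : ℝ} (hτ : 0 < τ)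
    (hM : M.IsInfSupStable C) (hm : 0 ≤ m) (hX : IsDiscreteSolution c M τ Θprev X)
    (hY : IsDiscreteSolution c M τ Θprev Y) (hYm : ∀ᵐ x ∂volume.restrict Ω, ‖Y.u.toL2 x‖ ≤ m)
    (hu : ‖X.u.toL2 - Y.u.toL2‖ ≤ E * ‖hc.saturation X.Θ - hc.saturation Y.Θ‖)
    (hS : hc.saturation X.Θ = hc.saturation Y.Θ) : X = Y := by
  have hS0 : hc.saturation X.Θ - hc.saturation Y.Θ = 0 := sub_eq_zero.2 hS
  have hF : hc.convectiveFlux X - hc.convectiveFlux Y = 0 := by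
    simpa only [hS0, norm_zero, mul_zero, norm_le_zero_iff] using
      norm_convectiveFlux_sub_le hc hYm hu
  have hq : X.q.toL2 - Y.q.toL2 = 0 := by
    simpa only [hS0, hF, inner_zero_left, zero_add, mul_zero, mul_eq_zero, hτ.ne', false_or,
      sq_eq_zero_iff, norm_eq_zero] using hX.inner_saturation_sub_add_norm_flux_sub_sq hc hΩo hY
  have hu0 : X.u.toL2 - Y.u.toL2 = 0 := by
    simpa only [hS0, norm_zero, mul_zero, norm_le_zero_iff] using hu
  have hp : X.p - Y.p = 0 := by
    simpa only [hS0, hu0, norm_zero, mul_zero, add_zero, norm_le_zero_iff] using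
      hX.norm_pressure_sub_le hc hM hm hY hYm
  have hΘ : X.Θ - Y.Θ = 0 := by
    refine norm_le_zero_iff.1 ((hM _ (SimplicialMesh.sub_mem_Wh hX.Θ_mem hY.Θ_mem) 0 le_rfl
      fun v hv => ?_).trans_eq (mul_zero C))
    have hXv := hX.inner_flux hc hv
    rw [sub_eq_zero.1 hq, sub_eq_zero.1 hF, ← hY.inner_flux hc hv] at hXv
    rw [inner_sub_left, zero_mul]
    linarith
  exact FlowState.ext_of_sub_eq_zero hΘ hq hp hu0

end IsDiscreteSolution

end Uniqueness

end

theorem mainTheorem5_general {d : ℕ} (hd : 1 ≤ d) (Ω : Set (Euc d)) (hΩo : IsOpen Ω)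
    (hΩb : Bornology.IsBounded Ω) (h0 : volume (frontier Ω) = 0)
    (c : FlowCoeffs d) {K : ℝ≥0} {B α : ℝ} (hα : 0 < α) (hc : c.IsRegular K B α) (σ Mu : ℝ) :
    ∃ τ₀ : ℝ, 0 < τ₀ ∧
      ∀ M : SimplicialMesh Ω, M.IsShapeRegular σ →
        ∀ τ : ℝ, 0 < τ → τ ≤ τ₀ →
          ∀ Θprev : L2Scal Ω, TotalFluxBound c M τ Θprev Mu →
            {X : FlowState Ω | IsDiscreteSolution c M τ Θprev X}.Subsingleton := by
  have : IsFiniteMeasure (volume.restrict Ω) := isFiniteMeasure_restrict.2 hΩb.measure_lt_top.ne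
  obtain ⟨C, hC, hstable⟩ := SimplicialMesh.exists_isInfSupStable hd hΩo hΩb h0 σ
  set m := max Mu 0
  set E := max 1 ((K * C * B + K * (m + 1) + K * C * (K * (m + 1))) / α)
  set L := K * (B * E + K * (m + 1)) ^ 2
  have hL : 0 < L + 1 := by positivity
  refine ⟨1 / (L + 1), by positivity, fun M hM τ hτ hτ0 Θprev hbound X hX Y hY => ?_⟩
  have hm : 0 ≤ m := le_max_right _ _
  have hYm := (hbound Y hY).mono fun x hx => hx.trans (le_max_left Mu 0)
  have hu := hX.norm_total_flux_sub_le hc hΩo hα hC (hstable M hM) hm hY hYm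
  have hsmall : L * τ < 4 := by
    rw [le_div_iff₀ hL] at hτ0
    linarith
  exact hX.eq_of_saturation_eq hc hΩo hτ (hstable M hM) hm hY hYm hu
    (hX.saturation_eq_of_norm_total_flux_sub_le hc hΩo hτ hsmall hY hYm hu)

theorem mainTheorem5 {d : ℕ} (hd : 1 ≤ d) (Ω : Set (Euc d)) (hΩo : IsOpen Ω)
    (hΩb : Bornology.IsBounded Ω) (hΩl : HasLipschitzBoundary Ω)
    (c : FlowCoeffs d) (hc : c.Admissible) (σ Mu : ℝ) :
    ∃ τ₀ : ℝ, 0 < τ₀ ∧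
      ∀ M : SimplicialMesh Ω, M.IsShapeRegular σ →
        ∀ τ : ℝ, 0 < τ → τ ≤ τ₀ →
          ∀ Θprev : L2Scal Ω, TotalFluxBound c M τ Θprev Mu →
            {X : FlowState Ω | IsDiscreteSolution c M τ Θprev X}.Subsingleton := by
  obtain ⟨K, B, α, hα, hreg⟩ := hc.exists_isRegular
  exact mainTheorem5_general hd Ω hΩo hΩb (hΩl.volume_frontier hΩo) c hα hreg σ Mu
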